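/- **Planted matching model.** Let $d\ge 0$ be a constant, let $\mathcal P,\mathcal Q$ be probability measures on a measurable space $\mathcal X$, and let $n\ge d$. A perfect matching $M^*$ of the complete bipartite graph $K_{n,n}$ is drawn uniformly at random. Every node pair in $M^*$ is connected by an edge, and every other node pair is connected independently with probability $d/n$. Independently, edges in $M^*$ receive weights drawn from $\mathcal P$, all other edges receive weights drawn from $\mathcal Q$. The resulting weighted graph $G$ is observed. An estimator is a measurable function $\hat M=\hat M(G)$ whose values are sets of node pairs; its average reconstruction error is $\mathbb E[\ell(M^*,\hat M)]$ with $\ell(M^*,\hat M)=\frac1n|M^*\triangle\hat M|$, and the optimal error $R_n(d)$ is the infimum of the average errors of all estimators. A maximum likelihood estimator (MLE) $\hat M_{\mathsf{ML}}$ is an estimator that always maximizes $\sum_{e\in M}\log\frac{\mathcal P}{\mathcal Q}(W_e)$ over all perfect matchings $M$ of $K_{n,n}$, where $W_e$ is the weight of $e$ and a node pair that is not connected in $G$ contributes $-\infty$. **Theorem (unweighted case $\mathcal P=\mathcal Q$).** There are universal constants $c,C>0$ (in particular independent of $\mathcal X$, $\mathcal P$, $d$, $\varepsilon$, $n$) such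 that the following holds for the model with $\mathcal Q=\mathcal P$. 1. For all $0<\varepsilon\le 1$ and all $d\ge(1+\varepsilon)^2$ (in particular for $d=(1+\varepsilon)^2$) there is $n_0=n_0(\varepsilon,d)$ such that for all $n\ge n_0$, all $\mathcal P$ and every estimator $\hat M$, $\ \mathbb E[\ell(M^*,\hat M)]\ge c\,\varepsilon^8$. 2. For all $\varepsilon>0$ and all $0\le d\le(1+\varepsilon)^2$ (in particular for $d=(1+\varepsilon)^2$) there is $n_0=n_0(\varepsilon,d)$ such that for all $n\ge n_0$, all $\mathcal P$ and every MLE, $\ \mathbb E[\ell(M^*,\hat M_{\mathsf{ML}})]\le C\,\varepsilon$. 3. The phase transition takes place at $d=1$ and is of finite order: for each $d\ge0$, $R_n(d)\to0$ as $n\to\infty$ if and only if $d\le 1$; and every limiting optimal error $R$, that is, every function $R:\mathbb R\to\mathbb R$ such that $R(d)$ is a subsequential limit of $R_n(d)$ as $n\to\infty$ for each $d\ge0$ (for instance $R(d)=\lim_n R_n(d)$ if these limits exist), is continuous at $d=1$ but is not eight times continuously differentiable in any neighbourhood of $d=1$. -/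

import Mathlib

open MeasureTheory Filter Topology

universe u

namespace PlantedMatching

/-- A node pair `(i, j')` of `K_{n,n}`: left vertex `i`, right vertex `j'`. -/
abbrev Pair (n : ℕ) : Type := Fin n × Fin n

/-- The observation: each node pair carries either the weight `Sum.inl x` of the edge that joins it,
or the symbol `Sum.inr ()` if the pair is not connected. -/
abbrev Observation (n : ℕ) (X : Type*) : Type _ := Pair n → X ⊕ Unit

/-- The perfect matching `{(i, σ(i)') : i}` of `K_{n,n}`; `σ ↦ matching σ` is a bijection from the
permutations of `{1, …, n}` to the perfect matchings of `K_{n,n}`. -/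
def matching {n : ℕ} (σ : Equiv.Perm (Fin n)) : Finset (Pair n) :=
  Finset.univ.image fun i => (i, σ i)

/-- The reconstruction error `|M ∆ M'| / n`. -/
noncomputable def loss {n : ℕ} (M M' : Finset (Pair n)) : ℝ :=
  ((symmDiff M M').card : ℝ) / n

section Model

variable {X : Type*} [MeasurableSpace X]

/-- Law of the observation on a planted pair: always connected, weight distributed as `P`. -/
noncomputable def plantedLaw (P : Measure X) : Measure (X ⊕ Unit) :=
  P.map Sum.inl

/-- Law of the observation on an unplanted pair: connected with probability `d / n`, and then
with a weight distributed as `Q`. -/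
noncomputable def unplantedLaw (n : ℕ) (d : ℝ) (Q : Measure X) : Measure (X ⊕ Unit) :=
  ENNReal.ofReal (d / n) • Q.map Sum.inl
    + ENNReal.ofReal (1 - d / n) • Measure.dirac (Sum.inr ())

open Classical in
/-- The conditional law of the observation, given that the planted matching is `M`: the pairs are
independent, the planted ones are in `M`. -/
noncomputable def observationLaw (n : ℕ) (d : ℝ) (P Q : Measure X) (M : Finset (Pair n)) :
    Measure (Observation n X) :=
  Measure.pi fun e => if e ∈ M then plantedLaw P else unplantedLaw n d Q

/-- The average reconstruction error `𝔼[ℓ(M*, M̂)]` of the estimator `M̂`, where `M*` is uniformly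
distributed on the `n!` perfect matchings. -/
noncomputable def avgError (n : ℕ) (d : ℝ) (P Q : Measure X)
    (Mhat : Observation n X → Finset (Pair n)) : ℝ :=
  (∑ σ : Equiv.Perm (Fin n),
      ∫ w, loss (matching σ) (Mhat w) ∂(observationLaw n d P Q (matching σ))) / (n.factorial : ℝ)

/-- The optimal reconstruction error: the infimum of the average reconstruction error over all
estimators, that is, over all measurable functions from observations to sets of node pairs. -/
noncomputable def optimalError (n : ℕ) (d : ℝ) (P Q : Measure X) : ℝ :=
  ⨅ Mhat : {f : Observation n X → Finset (Pair n) // Measurable f}, avgError n d P Q Mhat.1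

/-- The log-likelihood ratio `log (P/Q)` of the observation on one pair, equal to `-∞` if the pair
is not connected (an unconnected pair cannot be planted). Here `P ≪ Q`. -/
noncomputable def logLR (P Q : Measure X) : X ⊕ Unit → EReal
  | Sum.inl x => ENNReal.log (P.rnDeriv Q x)
  | Sum.inr _ => ⊥

/-- `M̂` is a maximum likelihood estimator: its value is always a perfect matching `M` that
maximizes `∑_{e ∈ M} log (P/Q)(W_e)` over all perfect matchings. -/
def IsMLE {n : ℕ} (P Q : Measure X) (Mhat : Observation n X → Finset (Pair n)) : Prop :=
  Measurable Mhat ∧ ∀ w : Observation n X,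
    (∃ σ : Equiv.Perm (Fin n), Mhat w = matching σ) ∧
    ∀ τ : Equiv.Perm (Fin n),
      ∑ e ∈ matching τ, logLR P Q (w e) ≤ ∑ e ∈ Mhat w, logLR P Q (w e)

/-- `R` is a limiting optimal reconstruction error of the model as a function of the average
degree `d`: for each `d ≥ 0`, `R d` is a limit of the optimal errors along `n → ∞`
or at least along a subsequence (so nothing is presupposed about the existence of the limit). -/
def IsLimitingError (P Q : Measure X) (R : ℝ → ℝ) : Prop :=
  ∀ d : ℝ, 0 ≤ d → MapClusterPt (R d) atTop fun n : ℕ => optimalError n d P Q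

end Model

end PlantedMatching

namespace PlantedMatching

/-! ### Expectations over random sets with independent membership. -/

section Bernoulli

/-! Relabelling the right vertices makes the planted matching the identity. The other connected
pairs then form a random digraph on `n` vertices with arc probability `d / n`, and the perfect
matchings of the observed graph are the permutations whose moved points follow arcs. The loss of
such a permutation is `2 / n` times the size of its support. As `P = Q`, weights carry no
information: an MLE is almost surely some perfect matching of the graph, and the posterior is
uniform on these (`bernWeight_connProb`).

Upper bound: a moved vertex lies on a short cycle or starts a long path (`walk_of_perm`). Short
cycles are rare since their expected number is bounded. For long paths, averaging over the arcs out
of the first vertex gives a concave function of the number of possible continuations. Bounding it by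
a tangent line leaves only expectations, so no independence of continuations is needed, and a
tangent away from zero turns the recursion into a contraction whose fixed point is of order `ε`
(`bernExp_path_le`, `exists_support_bound`).

Lower bound: by the triangle inequality an estimator errs by at least half the mean distance of two
posterior samples (`le_avgError`), so it suffices that permutations of small support are a minority.
Multiplying such a permutation by a long cycle off its support gives one of large support. Each
small one has more than `K` such extensions, while each large one arises at most `n / (m + 1) ≤ K`
times (`card_small_support_le`). The many long cycles must survive the deletion of every small
vertex set, so their absence must be exponentially unlikely. A depth-first search is run as a
betting game: either too few arcs are met, or a path of linear length appears, whose quadratically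
many unqueried backward arcs close distinct long cycles (`exists_dfs_tests`,
`bernExp_few_cycles_le`). A union bound follows (`exists_many_cycles`).

Passing to cluster points, a limiting error is zero up to `d = 1`, at most linear in `d - 1` beyond
it, and at least of order `(d - 1) ^ 8` near it; Taylor's theorem then rules out eight continuous
derivatives. -/

lemma apply_erase_of_insert {E β : Type*} [DecidableEq E] {f : Finset E → β} {e : E}
    (h : ∀ A, f (insert e A) = f A) (A : Finset E) : f (A.erase e) = f A := by
  by_cases he : e ∈ A
  · rw [← h (A.erase e), Finset.insert_erase he]
  · rw [Finset.erase_eq_of_notMem he]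

open Classical in
/-- The indicator of a proposition, as a real number. -/
noncomputable def ind (p : Prop) : ℝ := if p then 1 else 0

lemma ind_of_true {p : Prop} (h : p) : ind p = 1 := if_pos h

lemma ind_of_false {p : Prop} (h : ¬ p) : ind p = 0 := if_neg h

lemma ind_nonneg (p : Prop) : 0 ≤ ind p := by
  unfold ind; split_ifs <;> norm_num

lemma ind_le_one (p : Prop) : ind p ≤ 1 := by
  unfold ind; split_ifs <;> norm_num

lemma ind_le_of_imp {p : Prop} {r : ℝ} (hr : 0 ≤ r) (h : p → 1 ≤ r) : ind p ≤ r := by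
  by_cases hp : p
  · rw [ind_of_true hp]; exact h hp
  · rwa [ind_of_false hp]

lemma ind_congr {p q : Prop} (h : p ↔ q) : ind p = ind q := by rw [propext h]

variable {E : Type*} [Fintype E] [DecidableEq E]

/-- The probability that the random set which contains each `e` independently with probability `c e`
equals `A`. -/
def bernWeight (c : E → ℝ) (A : Finset E) : ℝ := ∏ e, if e ∈ A then c e else 1 - c e

/-- The expectation of `f` at the random set which contains each `e` independently with
probability `c e`. -/
def bernExp (c : E → ℝ) (f : Finset E → ℝ) : ℝ := ∑ A, bernWeight c A * f A

variable {c : E → ℝ} {f g : Finset E → ℝ}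

lemma bernWeight_nonneg (hc : ∀ e, c e ∈ Set.Icc (0 : ℝ) 1) (A : Finset E) :
    0 ≤ bernWeight c A := by
  refine Finset.prod_nonneg fun e _ => ?_
  split_ifs
  · exact (hc e).1
  · linarith [(hc e).2]

lemma sum_bernWeight (c : E → ℝ) : ∑ A, bernWeight c A = 1 := by
  have h := Finset.prod_add c (fun e => 1 - c e) Finset.univ
  simp only [add_sub_cancel, Finset.prod_const_one, Finset.powerset_univ] at h
  rw [h]
  refine Finset.sum_congr rfl fun A _ => ?_
  rw [bernWeight, Finset.prod_ite]
  congr 1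
  · exact Finset.prod_congr (by ext; simp) fun _ _ => rfl
  · exact Finset.prod_congr (by ext; simp) fun _ _ => rfl

lemma bernExp_const (c : E → ℝ) (r : ℝ) : bernExp c (fun _ => r) = r := by
  rw [bernExp, ← Finset.sum_mul, sum_bernWeight, one_mul]

lemma bernExp_mono (hc : ∀ e, c e ∈ Set.Icc (0 : ℝ) 1) (h : ∀ A, f A ≤ g A) :
    bernExp c f ≤ bernExp c g :=
  Finset.sum_le_sum fun A _ => mul_le_mul_of_nonneg_left (h A) (bernWeight_nonneg hc A)

lemma bernExp_add (c : E → ℝ) (f g : Finset E → ℝ) :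
    bernExp c (fun A => f A + g A) = bernExp c f + bernExp c g := by
  simp only [bernExp, mul_add, Finset.sum_add_distrib]

lemma bernExp_const_mul (c : E → ℝ) (r : ℝ) (f : Finset E → ℝ) :
    bernExp c (fun A => r * f A) = r * bernExp c f := by
  simp only [bernExp, Finset.mul_sum]
  exact Finset.sum_congr rfl fun A _ => by ring

lemma bernExp_sum {ι : Type*} (c : E → ℝ) (s : Finset ι) (f : ι → Finset E → ℝ) :
    bernExp c (fun A => ∑ i ∈ s, f i A) = ∑ i ∈ s, bernExp c (f i) := by
  simp only [bernExp, Finset.mul_sum]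
  exact Finset.sum_comm

lemma bernExp_one_sub (c : E → ℝ) (f : Finset E → ℝ) :
    bernExp c (fun A => 1 - f A) = 1 - bernExp c f := by
  have := bernExp_add c (fun A => 1 - f A) f
  simp only [sub_add_cancel, bernExp_const] at this
  linarith

/-- Resampling the membership of a single element. -/
lemma bernExp_resample (c : E → ℝ) (f : Finset E → ℝ) (e : E) :
    bernExp c f = bernExp c fun A => c e * f (insert e A) + (1 - c e) * f (A.erase e) := by
  have split : ∀ h : Finset E → ℝ, ∑ A, h A =
      ∑ A ∈ (Finset.univ.erase e).powerset, (h A + h (insert e A)) := by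
    intro h
    have := Finset.sum_powerset_insert (Finset.notMem_erase e Finset.univ) h
    rw [Finset.insert_erase (Finset.mem_univ e), Finset.powerset_univ] at this
    rw [this, Finset.sum_add_distrib]
  rw [bernExp, bernExp, split, split]
  refine Finset.sum_congr rfl fun A hA => ?_
  have heA : e ∉ A := fun h => Finset.notMem_erase e _ (Finset.mem_powerset.1 hA h)
  have h1 : bernWeight c A =
      (1 - c e) * ∏ x ∈ Finset.univ.erase e, if x ∈ A then c x else 1 - c x := by
    rw [bernWeight, ← Finset.mul_prod_erase _ _ (Finset.mem_univ e), if_neg heA]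
  have h2 : bernWeight c (insert e A) =
      c e * ∏ x ∈ Finset.univ.erase e, if x ∈ A then c x else 1 - c x := by
    rw [bernWeight, ← Finset.mul_prod_erase _ _ (Finset.mem_univ e),
      if_pos (Finset.mem_insert_self e A)]
    congr 1
    refine Finset.prod_congr rfl fun x hx => ?_
    simp [Finset.mem_insert, Finset.ne_of_mem_erase hx]
  rw [h1, h2, Finset.insert_idem, Finset.erase_eq_of_notMem heA, Finset.erase_insert heA]
  ring

end Bernoulli

/-! ### First-step recursion for self-avoiding paths in a random digraph. -/

section Walk

variable {V : Type*} [DecidableEq V]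

/-- There is a directed path of length `k` from `x` with arcs in `A`, all whose further vertices are
distinct and in `U`, and whose last vertex satisfies `base`. -/
def Walk (A : Finset (V × V)) (base : V → Prop) : ℕ → V → Finset V → Prop
  | 0, x, _ => base x
  | k + 1, x, U => ∃ u ∈ U, (x, u) ∈ A ∧ Walk A base k u (U.erase u)

/-- Such a path never leaves `y`, so arcs out of `y` are irrelevant. This decouples the first step
of a path from its continuation. -/
lemma walk_insert_iff {base : Finset (V × V) → V → Prop}
    (hb : ∀ A x y z, y ≠ x → (base (insert (y, z) A) x ↔ base A x)) (A : Finset (V × V))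
    (y z : V) (k : ℕ) : ∀ (x : V) (U : Finset V), y ≠ x → y ∉ U →
      (Walk (insert (y, z) A) (base (insert (y, z) A)) k x U ↔ Walk A (base A) k x U) := by
  induction k with
  | zero => intro x U hx _; exact hb A x y z hx
  | succ k ih =>
    intro x U hx hU
    simp only [Walk]
    refine exists_congr fun u => and_congr_right fun hu => and_congr ?_ ?_
    · simp [hx.symm]
    · exact ih u _ (fun h => hU (h ▸ hu)) fun h => hU (Finset.mem_of_mem_erase h)

variable [Fintype V]

/-- Averaging over the arcs out of `v`. -/
lemma bernExp_prod_out (c : V × V → ℝ) (v : V) (Y : V → Finset (V × V) → ℝ)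
    (hY : ∀ u w A, Y u (insert (v, w) A) = Y u A) (U : Finset V) :
    ∀ g : Finset (V × V) → ℝ, (∀ w A, g (insert (v, w) A) = g A) →
      bernExp c (fun A => (∏ u ∈ U, (1 - ind ((v, u) ∈ A) * Y u A)) * g A) =
        bernExp c (fun A => (∏ u ∈ U, (1 - c (v, u) * Y u A)) * g A) := by
  induction U using Finset.induction_on with
  | empty => intro g _; simp
  | insert a U ha ih =>
    intro g hg
    -- The factor of the arc to `a`, already averaged, is absorbed into `g`; hence the generality in
    -- `g`.
    have key := ih (fun A => (1 - c (v, a) * Y a A) * g A) (fun w A => by rw [hY, hg])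
    calc _ = bernExp c (fun A => (∏ u ∈ U, (1 - ind ((v, u) ∈ A) * Y u A)) *
            ((1 - c (v, a) * Y a A) * g A)) := by
          rw [bernExp_resample c _ (v, a)]
          congr 1
          funext A
          have hY' : ∀ u, Y u (A.erase (v, a)) = Y u A :=
            fun u => apply_erase_of_insert (fun B => hY u a B) A
          have hg' : g (A.erase (v, a)) = g A := apply_erase_of_insert (fun B => hg a B) A
          have h1 : ∏ u ∈ U, (1 - ind ((v, u) ∈ insert (v, a) A) * Y u A) =
              ∏ u ∈ U, (1 - ind ((v, u) ∈ A) * Y u A) := by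
            refine Finset.prod_congr rfl fun u hu => ?_
            have : u ≠ a := fun h => ha (h ▸ hu)
            simp [this]
          have h2 : ∏ u ∈ U, (1 - ind ((v, u) ∈ A.erase (v, a)) * Y u A) =
              ∏ u ∈ U, (1 - ind ((v, u) ∈ A) * Y u A) := by
            refine Finset.prod_congr rfl fun u hu => ?_
            have : u ≠ a := fun h => ha (h ▸ hu)
            simp [this]
          simp only [Finset.prod_insert ha, hY, hY', hg, hg', h1, h2,
            ind_of_true (Finset.mem_insert_self (v, a) A),
            ind_of_false (Finset.notMem_erase (v, a) A)]
          ring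
      _ = _ := by
          rw [key]
          congr 1
          funext A
          rw [Finset.prod_insert ha]
          ring

/-- With all other arcs fixed, no path starts at `x` with probability `(1 - p) ^ y`, where `y`
counts the vertices of `U` at which a continuation starts. The affine bound makes the average depend
only on the mean of `y`, so the continuations may be dependent. -/
lemma bernExp_walk_succ_le {c : V × V → ℝ} (hc : ∀ e, c e ∈ Set.Icc (0 : ℝ) 1)
    {p α β : ℝ} (hp : ∀ x y : V, x ≠ y → c (x, y) = p)
    (hαβ : ∀ y : ℕ, 1 - (1 - p) ^ y ≤ α + β * y)
    {base : Finset (V × V) → V → Prop}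
    (hb : ∀ A x y z, y ≠ x → (base (insert (y, z) A) x ↔ base A x))
    (k : ℕ) (x : V) (U : Finset V) (hx : x ∉ U) :
    bernExp c (fun A => ind (Walk A (base A) (k + 1) x U)) ≤
      α + β * ∑ u ∈ U, bernExp c (fun A => ind (Walk A (base A) k u (U.erase u))) := by
  classical
  set Y : V → Finset (V × V) → ℝ := fun u A =>
    if u ∈ U then ind (Walk A (base A) k u (U.erase u)) else 0 with hYdef
  have hY : ∀ u w A, Y u (insert (x, w) A) = Y u A := by
    intro u w A
    simp only [hYdef]
    split_ifs with hu
    · exact ind_congr (walk_insert_iff hb A x w k u _ (fun h => hx (h ▸ hu))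
        fun h => hx (Finset.mem_of_mem_erase h))
    · rfl
  have hYU : ∀ u ∈ U, ∀ A, Y u A = ind (Walk A (base A) k u (U.erase u)) :=
    fun u hu A => if_pos hu
  have h1 : ∀ A, ind (Walk A (base A) (k + 1) x U) ≤
      1 - (∏ u ∈ U, (1 - ind ((x, u) ∈ A) * Y u A)) * 1 := by
    intro A
    have hnn : ∀ u ∈ U, 0 ≤ 1 - ind ((x, u) ∈ A) * Y u A := fun u hu => by
      rw [hYU u hu]
      nlinarith [ind_nonneg ((x, u) ∈ A), ind_le_one ((x, u) ∈ A),
        ind_le_one (Walk A (base A) k u (U.erase u)),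
        ind_nonneg (Walk A (base A) k u (U.erase u))]
    have hle : ∀ u ∈ U, 1 - ind ((x, u) ∈ A) * Y u A ≤ 1 := fun u hu => by
      rw [hYU u hu]
      nlinarith [ind_nonneg ((x, u) ∈ A), ind_nonneg (Walk A (base A) k u (U.erase u))]
    refine ind_le_of_imp ?_ ?_
    · have := Finset.prod_le_one hnn hle
      linarith
    · rintro ⟨u, hu, hxu, hw⟩
      have : ∏ u ∈ U, (1 - ind ((x, u) ∈ A) * Y u A) = 0 :=
        Finset.prod_eq_zero hu (by rw [hYU u hu, ind_of_true hxu, ind_of_true hw]; norm_num)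
      rw [this]; norm_num
  have h2 : ∀ A, 1 - (∏ u ∈ U, (1 - c (x, u) * Y u A)) * 1 ≤ α + β * ∑ u ∈ U, Y u A := by
    intro A
    have hsum : ∑ u ∈ U, Y u A =
        ((U.filter fun u => Walk A (base A) k u (U.erase u)).card : ℝ) := by
      rw [Finset.sum_congr rfl fun u hu => hYU u hu A]
      simp only [ind, Finset.sum_boole]
    have hprod : ∏ u ∈ U, (1 - c (x, u) * Y u A) =
        (1 - p) ^ (U.filter fun u => Walk A (base A) k u (U.erase u)).card := by
      rw [← Finset.prod_const, Finset.prod_filter]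
      refine Finset.prod_congr rfl fun u hu => ?_
      rw [hYU u hu, hp x u fun h => hx (h ▸ hu)]
      simp only [ind]
      split_ifs <;> simp
    rw [hsum, hprod, mul_one]
    exact hαβ _
  calc _ ≤ bernExp c (fun A => 1 - (∏ u ∈ U, (1 - ind ((x, u) ∈ A) * Y u A)) * 1) :=
        bernExp_mono hc h1
    _ = bernExp c (fun A => 1 - (∏ u ∈ U, (1 - c (x, u) * Y u A)) * 1) := by
        rw [bernExp_one_sub, bernExp_one_sub,
          bernExp_prod_out c x Y hY U (fun _ => 1) fun _ _ => rfl]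
    _ ≤ bernExp c (fun A => α + β * ∑ u ∈ U, Y u A) := bernExp_mono hc h2
    _ = _ := by
        rw [bernExp_add, bernExp_const, bernExp_const_mul, bernExp_sum]
        congr 2
        exact Finset.sum_congr rfl fun u hu => congrArg _ (funext fun A => hYU u hu A)

end Walk

/-! ### Upper bound: short cycles and long paths. -/

section CycleBound

variable {V : Type*} [DecidableEq V]

lemma walk_of_seq {A : Finset (V × V)} {base : V → Prop} (k : ℕ) :
    ∀ (f : ℕ → V) (U : Finset V), (∀ i < k, (f i, f (i + 1)) ∈ A) →
      Set.InjOn f (Set.Icc 1 k) → (∀ i ∈ Set.Icc 1 k, f i ∈ U) → base (f k) →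
      Walk A base k (f 0) U := by
  induction k with
  | zero => intro f U _ _ _ hb; exact hb
  | succ k ih =>
    intro f U harc hinj hU hb
    refine ⟨f 1, hU 1 ⟨le_rfl, by omega⟩, harc 0 (by omega), ?_⟩
    refine ih (fun i => f (i + 1)) _ (fun i hi => harc (i + 1) (by omega)) ?_ ?_ hb
    · intro i hi j hj hij
      have := hinj (x₁ := i + 1) (x₂ := j + 1) ⟨by omega, by have := hi.2; omega⟩
        ⟨by omega, by have := hj.2; omega⟩ hij
      omega
    · intro i hi
      have hi1 := hi.1
      have hi2 := hi.2
      refine Finset.mem_erase.2 ⟨fun h => ?_, hU (i + 1) ⟨by omega, by omega⟩⟩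
      have := hinj (x₁ := i + 1) (x₂ := 1) ⟨by omega, by omega⟩ ⟨by omega, by omega⟩ h
      omega

variable [Fintype V]

/-- A vertex moved by a permutation along arcs of `A` starts a long path or lies on a short cycle. -/
lemma walk_of_perm {A : Finset (V × V)} {π : Equiv.Perm V} (hπ : ∀ i, π i ≠ i → (i, π i) ∈ A)
    {v : V} (hv : π v ≠ v) (L : ℕ) :
    Walk A (fun _ => True) L v (Finset.univ.erase v) ∨
      ∃ k ∈ Finset.range L, Walk A (fun x => (x, v) ∈ A) (k + 1) v (Finset.univ.erase v) := by
  have hmove : ∀ i : ℕ, π ((π ^ i) v) ≠ (π ^ i) v := by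
    intro i h
    apply hv
    have : (π ^ i) (π v) = (π ^ i) v := by
      rw [← Equiv.Perm.mul_apply, ← pow_succ, pow_succ', Equiv.Perm.mul_apply, h]
    exact (π ^ i).injective this
  have harc : ∀ i : ℕ, ((π ^ i) v, (π ^ (i + 1)) v) ∈ A := by
    intro i
    rw [pow_succ', Equiv.Perm.mul_apply]
    exact hπ _ (hmove i)
  have hit : ∀ i : ℕ, (π ^ i) v = (π : V → V)^[i] v := fun i => by
    rw [Equiv.Perm.iterate_eq_pow]
  set m := Function.minimalPeriod π v with hm
  have hper : v ∈ Function.periodicPts π := by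
    refine ⟨orderOf π, orderOf_pos π, ?_⟩
    rw [Function.IsPeriodicPt, Function.IsFixedPt, ← hit, pow_orderOf_eq_one]
    rfl
  have hmpos : 0 < m := Function.minimalPeriod_pos_of_mem_periodicPts hper
  have hinj : ∀ i j : ℕ, i < m → j < m → (π ^ i) v = (π ^ j) v → i = j := by
    intro i j hi hj h
    rw [hit, hit] at h
    exact (Function.iterate_eq_iterate_iff_of_lt_minimalPeriod hi hj).1 h
  have hm1 : m ≠ 1 := fun h => hv (Function.minimalPeriod_eq_one_iff_isFixedPt.1 h)
  have hlast : (π ^ m) v = v := by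
    rw [hit]; exact Function.iterate_minimalPeriod
  have main : ∀ (base : V → Prop) (k : ℕ), k < m → base ((π ^ k) v) →
      Walk A base k v (Finset.univ.erase v) := by
    intro base k hk hb
    refine walk_of_seq k (fun i => (π ^ i) v) _ (fun i _ => harc i) ?_ ?_ hb
    · intro i hi j hj h
      exact hinj i j (lt_of_le_of_lt hi.2 hk) (lt_of_le_of_lt hj.2 hk) h
    · intro i hi
      refine Finset.mem_erase.2 ⟨fun h => ?_, Finset.mem_univ _⟩
      have := hinj i 0 (lt_of_le_of_lt hi.2 hk) hmpos h
      have := hi.1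
      omega
  rcases lt_or_ge L m with h | h
  · exact Or.inl (main _ L h trivial)
  -- A cycle of length `m ≥ 2` is a path with `m - 1 = (m - 2) + 1` arcs followed by the closing arc
  -- to `v`.
  · refine Or.inr ⟨m - 2, Finset.mem_range.2 (by omega), ?_⟩
    refine main _ _ (by omega) ?_
    have := harc (m - 1)
    rw [Nat.sub_add_cancel hmpos, hlast] at this
    rwa [show m - 2 + 1 = m - 1 by omega]

/-- First-moment bound: the recursion is used with Bernoulli's inequality `1 - (1 - p) ^ y ≤ p * y`.
The target `v` stays outside `U`, so the closing arc is still fresh; only for `k = 0` must `x ≠ v`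
be assumed. -/
lemma bernExp_cycle_le {c : V × V → ℝ} (hc : ∀ e, c e ∈ Set.Icc (0 : ℝ) 1) {p : ℝ}
    (hp0 : 0 ≤ p) (hp1 : p ≤ 1) (hp : ∀ x y : V, x ≠ y → c (x, y) = p) (v : V) (k : ℕ) :
    ∀ (x : V) (U : Finset V), x ∉ U → v ∉ U → (k = 0 → x ≠ v) →
      bernExp c (fun A => ind (Walk A (fun x => (x, v) ∈ A) k x U)) ≤
        p * (Fintype.card V * p) ^ k := by
  have hb : ∀ (A : Finset (V × V)) (x y z : V), y ≠ x →
      ((x, v) ∈ insert (y, z) A ↔ (x, v) ∈ A) := by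
    intro A x y z h
    simp [h.symm]
  induction k with
  | zero =>
    intro x U _ _ hxv
    rw [bernExp_resample c _ (x, v)]
    simp only [Walk, Finset.mem_insert_self, Finset.notMem_erase, ind_of_true, ind_of_false,
      not_false_eq_true, bernExp_const, hp x v (hxv rfl)]
    simp
  | succ k ih =>
    intro x U hx hv _
    refine (bernExp_walk_succ_le hc hp (α := 0) (β := p) ?_ hb k x U hx).trans ?_
    · intro y
      have := one_add_mul_le_pow (show (-2 : ℝ) ≤ -p by linarith) y
      rw [← sub_eq_add_neg] at this
      linarith
    · rw [zero_add]
      have : ∑ u ∈ U, bernExp c (fun A => ind (Walk A (fun x => (x, v) ∈ A) k u (U.erase u))) ≤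
          Fintype.card V * (p * (Fintype.card V * p) ^ k) := by
        refine (Finset.sum_le_card_nsmul _ _ _ fun u hu => ih u _ (Finset.notMem_erase u U)
          (fun h => hv (Finset.mem_of_mem_erase h)) fun _ h => hv (h ▸ hu)).trans ?_
        rw [nsmul_eq_mul]
        have : (U.card : ℝ) ≤ Fintype.card V := by exact_mod_cast Finset.card_le_univ U
        gcongr
      calc _ ≤ p * (Fintype.card V * (p * (Fintype.card V * p) ^ k)) := by gcongr
        _ = _ := by ring

/-- The recursion is dominated by the affine contraction `s ↦ (1 - r) * a + r * s` with fixed point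
`a`, started at most `1` above it. -/
lemma bernExp_path_le {c : V × V → ℝ} (hc : ∀ e, c e ∈ Set.Icc (0 : ℝ) 1) {p α β r a : ℝ}
    (hp : ∀ x y : V, x ≠ y → c (x, y) = p) (hβ : 0 ≤ β) (ha : 0 ≤ a) (hr : 0 ≤ r)
    (hαβ : ∀ y : ℕ, 1 - (1 - p) ^ y ≤ α + β * y)
    (hβr : Fintype.card V * β ≤ r) (hα : α ≤ (1 - r) * a) (k : ℕ) :
    ∀ (x : V) (U : Finset V), x ∉ U →
      bernExp c (fun A => ind (Walk A (fun _ => True) k x U)) ≤ r ^ k + a := by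
  induction k with
  | zero =>
    intro x U _
    simp only [Walk, ind_of_true, bernExp_const]
    simpa using ha
  | succ k ih =>
    intro x U hx
    refine (bernExp_walk_succ_le hc hp hαβ (base := fun _ _ => True) (fun _ _ _ _ _ => Iff.rfl)
      k x U hx).trans ?_
    have hra : 0 ≤ r ^ k + a := by positivity
    have : ∑ u ∈ U, bernExp c (fun A => ind (Walk A (fun _ => True) k u (U.erase u))) ≤
        Fintype.card V * (r ^ k + a) := by
      refine (Finset.sum_le_card_nsmul _ _ _ fun u _ => ih u _ (Finset.notMem_erase u U)).trans ?_
      rw [nsmul_eq_mul]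
      have : (U.card : ℝ) ≤ Fintype.card V := by exact_mod_cast Finset.card_le_univ U
      gcongr
    calc _ ≤ (1 - r) * a + β * (Fintype.card V * (r ^ k + a)) := by gcongr
      _ = (1 - r) * a + (Fintype.card V * β) * (r ^ k + a) := by ring
      _ ≤ (1 - r) * a + r * (r ^ k + a) := by gcongr
      _ = _ := by ring

/-- Since `1 - p ≥ exp (-(1 + ε) * p)`, it suffices to put the convex function `exp (-s)` above its
tangent at `s = t`. The point `t` is free: a larger `t` lowers the slope at the price of an
intercept of order `t ^ 2`. -/
lemma one_sub_pow_le_tangent {p ε : ℝ} (hp : 0 ≤ p) (_hε : 0 < ε) (hε1 : ε ≤ 1) (hpε : p ≤ ε / 2)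
    (t : ℝ) (y : ℕ) :
    1 - (1 - p) ^ y ≤ (1 - Real.exp (-t) * (1 + t)) + Real.exp (-t) * ((1 + ε) * p) * y := by
  have h1 : Real.exp (-((1 + ε) * p)) ≤ 1 - p := by
    have h := Real.add_one_le_exp ((1 + ε) * p)
    have h2 : 1 ≤ (1 - p) * (1 + (1 + ε) * p) := by
      have : (1 + ε) * p ≤ ε := by nlinarith
      nlinarith [mul_nonneg hp (sub_nonneg.2 this)]
    rw [Real.exp_neg]
    have h3 : (Real.exp ((1 + ε) * p))⁻¹ * Real.exp ((1 + ε) * p) = 1 :=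
      inv_mul_cancel₀ (Real.exp_pos _).ne'
    have h4 : 0 < (Real.exp ((1 + ε) * p))⁻¹ := inv_pos.2 (Real.exp_pos _)
    have h5 : (1 : ℝ) ≤ (1 - p) * Real.exp ((1 + ε) * p) := by nlinarith
    calc _ = (Real.exp ((1 + ε) * p))⁻¹ * 1 := by ring
      _ ≤ (Real.exp ((1 + ε) * p))⁻¹ * ((1 - p) * Real.exp ((1 + ε) * p)) := by gcongr
      _ = 1 - p := by rw [mul_left_comm, h3, mul_one]
  have h2 : Real.exp (-((1 + ε) * p * y)) ≤ (1 - p) ^ y := by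
    calc _ = Real.exp (-((1 + ε) * p)) ^ y := by
          rw [← Real.exp_nat_mul]; congr 1; ring
      _ ≤ _ := by gcongr
  have h3 : Real.exp (-t) * (1 + (t - (1 + ε) * p * y)) ≤ Real.exp (-((1 + ε) * p * y)) := by
    have := Real.add_one_le_exp (t - (1 + ε) * p * y)
    calc _ ≤ Real.exp (-t) * Real.exp (t - (1 + ε) * p * y) := by
          gcongr; linarith
      _ = _ := by rw [← Real.exp_add]; congr 1; ring
  linarith

end CycleBound

/-- Every permutation along the arcs of the random digraph moves few vertices. -/
lemma exists_support_bound {ε d : ℝ} (hε : 0 < ε) (hε1 : ε ≤ 1) (hd0 : 0 ≤ d)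
    (hd : d ≤ (1 + ε) ^ 2) :
    ∃ n₀ : ℕ, ∀ n, n₀ ≤ n → ∀ c : Fin n × Fin n → ℝ, (∀ e, c e ∈ Set.Icc (0 : ℝ) 1) →
      (∀ x y, x ≠ y → c (x, y) = d / n) → ∃ f : Finset (Fin n × Fin n) → ℝ,
        (∀ A, ∀ π : Equiv.Perm (Fin n), (∀ i, π i ≠ i → (i, π i) ∈ A) → (π.support.card : ℝ) ≤ f A) ∧
        bernExp c f ≤ 34 * ε * n := by
  set r : ℝ := (1 + ε)⁻¹ with hr
  have hr0 : 0 < r := by positivity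
  have hr1 : r < 1 := inv_lt_one_of_one_lt₀ (by linarith)
  obtain ⟨L, hL⟩ := exists_pow_lt_of_lt_one hε hr1
  obtain ⟨n₁, hn₁⟩ := exists_nat_ge ((∑ k ∈ Finset.range L, d ^ (k + 2)) / ε)
  obtain ⟨n₂, hn₂⟩ := exists_nat_ge (2 * d / ε)
  refine ⟨max (max n₁ n₂) 1, fun n hn c hc hcp => ?_⟩
  have hn1 : 1 ≤ n := le_trans (le_max_right _ _) hn
  have hnn₁ : n₁ ≤ n := (le_max_left _ _).trans ((le_max_left _ _).trans hn)
  have hnn₂ : n₂ ≤ n := (le_max_right _ _).trans ((le_max_left _ _).trans hn)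
  have hnpos : (0 : ℝ) < n := by exact_mod_cast hn1
  set p : ℝ := d / n with hp
  have hp0 : 0 ≤ p := by positivity
  have hnp : (n : ℝ) * p = d := by rw [hp]; field_simp
  have hpε : p ≤ ε / 2 := by
    rw [hp, div_le_iff₀ hnpos]
    have : 2 * d / ε ≤ n := hn₂.trans (by exact_mod_cast hnn₂)
    rw [div_le_iff₀ hε] at this
    linarith
  -- Chosen so that `exp (-t) = r ^ 4`: the slope times `n` is then `r ^ 4 * (1 + ε) * d ≤ r < 1`,
  -- even though `d` may exceed one.
  set t : ℝ := 4 * Real.log (1 + ε) with ht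
  have ht0 : 0 ≤ t := by have := Real.log_nonneg (show (1 : ℝ) ≤ 1 + ε by linarith); positivity
  have htε : t ≤ 4 * ε := by
    have := Real.log_le_sub_one_of_pos (show (0 : ℝ) < 1 + ε by linarith)
    linarith
  have het : Real.exp (-t) = r ^ 4 := by
    rw [Real.exp_neg, ht, show (4 : ℝ) * Real.log (1 + ε) = (4 : ℕ) * Real.log (1 + ε) by norm_num,
      Real.exp_nat_mul, Real.exp_log (by linarith), hr, inv_pow]
  have hrε : r * (1 + ε) = 1 := inv_mul_cancel₀ (by linarith)
  refine ⟨fun A => ∑ v, (ind (Walk A (fun _ => True) L v (Finset.univ.erase v)) +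
    ∑ k ∈ Finset.range L, ind (Walk A (fun x => (x, v) ∈ A) (k + 1) v (Finset.univ.erase v))),
    fun A π hπ => ?_, ?_⟩
  · rw [← nsmul_one, ← Finset.sum_const]
    have hnn : ∀ v, 0 ≤ ind (Walk A (fun _ => True) L v (Finset.univ.erase v)) +
        ∑ k ∈ Finset.range L,
          ind (Walk A (fun x => (x, v) ∈ A) (k + 1) v (Finset.univ.erase v)) :=
      fun v => add_nonneg (ind_nonneg _) (Finset.sum_nonneg fun _ _ => ind_nonneg _)
    refine (Finset.sum_le_sum fun v hv => ?_).trans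
      (Finset.sum_le_univ_sum_of_nonneg hnn)
    have hsum : 0 ≤ ∑ k ∈ Finset.range L,
        ind (Walk A (fun x => (x, v) ∈ A) (k + 1) v (Finset.univ.erase v)) :=
      Finset.sum_nonneg fun _ _ => ind_nonneg _
    rcases walk_of_perm hπ (Equiv.Perm.mem_support.1 hv) L with h | ⟨k, hk, h⟩
    · rw [ind_of_true h]; linarith
    · have := Finset.single_le_sum (f := fun k =>
        ind (Walk A (fun x => (x, v) ∈ A) (k + 1) v (Finset.univ.erase v)))
        (fun _ _ => ind_nonneg _) hk
      simp only [ind_of_true h] at this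
      linarith [ind_nonneg (Walk A (fun _ => True) L v (Finset.univ.erase v))]
  · have h1 : ∀ v : Fin n, bernExp c (fun A =>
        ind (Walk A (fun _ => True) L v (Finset.univ.erase v))) ≤ r ^ L + 32 * ε := by
      intro v
      refine bernExp_path_le hc hcp (α := 1 - Real.exp (-t) * (1 + t))
        (β := Real.exp (-t) * ((1 + ε) * p)) (by positivity) (by positivity) hr0.le
        (fun y => one_sub_pow_le_tangent hp0 hε hε1 hpε t y) ?_ ?_ L v _
        (Finset.notMem_erase v _)
      · rw [Fintype.card_fin, het]
        calc (n : ℝ) * (r ^ 4 * ((1 + ε) * p)) = r ^ 3 * (r * (1 + ε)) * (n * p) := by ring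
          _ = r ^ 3 * d := by rw [hrε, hnp, mul_one]
          _ ≤ r ^ 3 * (1 + ε) ^ 2 := by gcongr
          _ = r * (r * (1 + ε)) ^ 2 := by ring
          _ = r := by rw [hrε]; ring
      -- The intercept is at most `t ^ 2 ≤ 16 * ε ^ 2`, and `1 - r ≥ ε / 2`; this is where the fixed
      -- point `32 * ε` comes from.
      · have h2 := Real.add_one_le_exp (-t)
        have h3 : (-t + 1) * (1 + t) ≤ Real.exp (-t) * (1 + t) := by gcongr
        have h4 : ε / 2 ≤ 1 - r := by nlinarith
        nlinarith
    have h2 : ∀ v : Fin n, ∀ k ∈ Finset.range L, bernExp c (fun A =>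
        ind (Walk A (fun x => (x, v) ∈ A) (k + 1) v (Finset.univ.erase v))) ≤
          p * d ^ (k + 1) := by
      intro v k _
      have := bernExp_cycle_le hc hp0 (by linarith) hcp v (k + 1) v _
        (Finset.notMem_erase v Finset.univ) (Finset.notMem_erase v _) (by simp)
      rwa [Fintype.card_fin, hnp] at this
    have h3 : ∑ k ∈ Finset.range L, p * d ^ (k + 1) ≤ ε := by
      have : (∑ k ∈ Finset.range L, d ^ (k + 2)) / ε ≤ n := hn₁.trans (by exact_mod_cast hnn₁)
      rw [div_le_iff₀ hε] at this
      have h4 : ∑ k ∈ Finset.range L, p * d ^ (k + 1) =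
          (∑ k ∈ Finset.range L, d ^ (k + 2)) / n := by
        rw [Finset.sum_div]
        refine Finset.sum_congr rfl fun k _ => ?_
        rw [hp]; ring
      rw [h4, div_le_iff₀ hnpos]
      linarith
    rw [bernExp_sum]
    refine (Finset.sum_le_card_nsmul _ _ (34 * ε) fun v _ => ?_).trans ?_
    · rw [bernExp_add, bernExp_sum]
      linarith [h1 v, Finset.sum_le_sum (h2 v)]
    · rw [Finset.card_univ, Fintype.card_fin, nsmul_eq_mul, mul_comm]

/-! ### Relabelling, and elements that are almost surely present. -/

section Relabel

variable {E : Type*} [Fintype E] [DecidableEq E]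

lemma bernExp_map (c : E → ℝ) (f : Finset E → ℝ) (φ : E ≃ E) :
    bernExp c f = bernExp (fun e => c (φ e)) (fun A => f (A.map φ.toEmbedding)) := by
  rw [bernExp, bernExp, ← Equiv.sum_comp φ.finsetCongr]
  refine Finset.sum_congr rfl fun A _ => ?_
  rw [Equiv.finsetCongr_apply]
  congr 1
  rw [bernWeight, bernWeight, ← Equiv.prod_comp φ]
  exact Finset.prod_congr rfl fun e _ => by simp

lemma bernExp_mono_of_subset {c : E → ℝ} {f g : Finset E → ℝ}
    (hc : ∀ e, c e ∈ Set.Icc (0 : ℝ) 1) (h : ∀ A, (∀ e, c e = 1 → e ∈ A) → f A ≤ g A) :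
    bernExp c f ≤ bernExp c g := by
  refine Finset.sum_le_sum fun A _ => ?_
  by_cases hA : ∀ e, c e = 1 → e ∈ A
  · exact mul_le_mul_of_nonneg_left (h A hA) (bernWeight_nonneg hc A)
  · push Not at hA
    obtain ⟨e, he, heA⟩ := hA
    have : bernWeight c A = 0 :=
      Finset.prod_eq_zero (Finset.mem_univ e) (by rw [if_neg heA, he, sub_self])
    rw [this, zero_mul, zero_mul]

end Relabel

/-! ### Perfect matchings as permutations, and the loss. -/

section Matchings

variable {n : ℕ}

lemma mem_matching {σ : Equiv.Perm (Fin n)} {e : Pair n} : e ∈ matching σ ↔ σ e.1 = e.2 := by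
  simp only [matching, Finset.mem_image, Finset.mem_univ, true_and]
  constructor
  · rintro ⟨i, rfl⟩; rfl
  · intro h; exact ⟨e.1, by rw [h]⟩

lemma card_matching (σ : Equiv.Perm (Fin n)) : (matching σ).card = n := by
  rw [matching, Finset.card_image_of_injective _ fun i j h => congrArg Prod.fst h,
    Finset.card_univ, Fintype.card_fin]

/-- The relabelling of the right vertices by `σ`. -/
def relabel (σ : Equiv.Perm (Fin n)) : Pair n ≃ Pair n := Equiv.prodCongr (Equiv.refl _) σ

lemma relabel_apply (σ : Equiv.Perm (Fin n)) (e : Pair n) : relabel σ e = (e.1, σ e.2) := rfl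

lemma mem_map_relabel {σ : Equiv.Perm (Fin n)} {A : Finset (Pair n)} {i j : Fin n} :
    (i, σ j) ∈ A.map (relabel σ).toEmbedding ↔ (i, j) ∈ A := by
  rw [show (i, σ j) = (relabel σ).toEmbedding (i, j) from rfl, Finset.mem_map' ]

/-- The perfect matchings contained in `G`. -/
def perfectMatchings (G : Finset (Pair n)) : Finset (Equiv.Perm (Fin n)) :=
  Finset.univ.filter fun σ => ∀ i, (i, σ i) ∈ G

lemma mem_perfectMatchings {G : Finset (Pair n)} {σ : Equiv.Perm (Fin n)} :
    σ ∈ perfectMatchings G ↔ ∀ i, (i, σ i) ∈ G := by simp [perfectMatchings]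

lemma matching_subset_iff {G : Finset (Pair n)} {σ : Equiv.Perm (Fin n)} :
    matching σ ⊆ G ↔ ∀ i, (i, σ i) ∈ G := by
  constructor
  · intro h i; exact h (mem_matching.2 rfl)
  · rintro h ⟨i, j⟩ he
    rw [mem_matching] at he
    simp only at he
    exact he ▸ h i

lemma mem_perfectMatchings_map_relabel {A : Finset (Pair n)} {σ π : Equiv.Perm (Fin n)} :
    σ * π ∈ perfectMatchings (A.map (relabel σ).toEmbedding) ↔ π ∈ perfectMatchings A := by
  simp only [mem_perfectMatchings, Equiv.Perm.mul_apply, mem_map_relabel]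

lemma loss_matching (σ τ : Equiv.Perm (Fin n)) :
    loss (matching σ) (matching τ) = 2 * ((σ⁻¹ * τ).support.card : ℝ) / n := by
  have h : ∀ σ τ : Equiv.Perm (Fin n),
      (matching σ \ matching τ).card = (σ⁻¹ * τ).support.card := by
    intro σ τ
    have : matching σ \ matching τ = (σ⁻¹ * τ).support.image fun i => (i, σ i) := by
      ext ⟨i, j⟩
      simp only [Finset.mem_sdiff, mem_matching, Finset.mem_image, Equiv.Perm.mem_support,
        Equiv.Perm.mul_apply, Prod.mk.injEq, ne_eq, Equiv.Perm.inv_eq_iff_eq]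
      constructor
      · rintro ⟨rfl, h⟩; exact ⟨i, fun h' => h h', rfl, rfl⟩
      · rintro ⟨i', h, rfl, rfl⟩; exact ⟨rfl, h⟩
    rw [this, Finset.card_image_of_injective _ fun i j h => congrArg Prod.fst h]
  have h2 : (τ⁻¹ * σ).support.card = (σ⁻¹ * τ).support.card := by
    rw [← Equiv.Perm.support_inv (σ⁻¹ * τ), mul_inv_rev, inv_inv]
  rw [loss, symmDiff_def, Finset.sup_eq_union,
    Finset.card_union_of_disjoint disjoint_sdiff_sdiff, h, h, h2]
  push_cast
  ring

lemma loss_nonneg (M M' : Finset (Pair n)) : 0 ≤ loss M M' := by unfold loss; positivity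

lemma loss_comm (M M' : Finset (Pair n)) : loss M M' = loss M' M := by
  rw [loss, loss, symmDiff_comm]

lemma loss_triangle (M₁ M₂ M₃ : Finset (Pair n)) : loss M₁ M₃ ≤ loss M₁ M₂ + loss M₂ M₃ := by
  rw [loss, loss, loss, ← add_div]
  gcongr
  have h : symmDiff M₁ M₃ ⊆ symmDiff M₁ M₂ ∪ symmDiff M₂ M₃ := symmDiff_triangle M₁ M₂ M₃
  exact_mod_cast (Finset.card_le_card h).trans (Finset.card_union_le _ _)

/-- Among the perfect matchings of `G`, no set of node pairs is closer on average than half the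
average distance of the matchings. -/
lemma sum_loss_ge (G M : Finset (Pair n)) :
    ∑ σ ∈ perfectMatchings G, (∑ τ ∈ perfectMatchings G, loss (matching σ) (matching τ)) /
      (2 * (perfectMatchings G).card) ≤ ∑ σ ∈ perfectMatchings G, loss (matching σ) M := by
  rcases (perfectMatchings G).eq_empty_or_nonempty with h | h
  · simp [h]
  have hpos : (0 : ℝ) < (perfectMatchings G).card := by exact_mod_cast h.card_pos
  rw [← Finset.sum_div, div_le_iff₀ (by positivity)]
  calc _ ≤ ∑ σ ∈ perfectMatchings G, ∑ τ ∈ perfectMatchings G,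
        (loss (matching σ) M + loss (matching τ) M) :=
        Finset.sum_le_sum fun σ _ => Finset.sum_le_sum fun τ _ => by
          rw [loss_comm (matching τ)]; exact loss_triangle _ _ _
    _ = _ := by
        simp only [Finset.sum_add_distrib, Finset.sum_const, nsmul_eq_mul, ← Finset.mul_sum]
        ring

end Matchings

/-! ### Law of the observation and posterior of the planted matching. -/

section Observation

variable {X : Type*} [MeasurableSpace X] {n : ℕ} {d : ℝ}

/-- The law of the observation given that `G` is the set of connected pairs, if all weights are
distributed as `P`. -/
noncomputable def weightLaw (P : Measure X) (G : Finset (Pair n)) : Measure (Observation n X) :=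
  Measure.pi fun e => if e ∈ G then P.map Sum.inl else Measure.dirac (Sum.inr ())

/-- The connection probabilities, given that `σ` is the planted matching. -/
noncomputable def connProb (n : ℕ) (d : ℝ) (σ : Equiv.Perm (Fin n)) (e : Pair n) : ℝ :=
  if e ∈ matching σ then 1 else d / n

lemma div_mem_Icc (hd : 0 ≤ d) (hdn : d ≤ n) : d / n ∈ Set.Icc (0 : ℝ) 1 :=
  ⟨by positivity, div_le_one_of_le₀ hdn (Nat.cast_nonneg n)⟩

lemma connProb_mem_Icc (hd : 0 ≤ d) (hdn : d ≤ n) (σ : Equiv.Perm (Fin n)) (e : Pair n) :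
    connProb n d σ e ∈ Set.Icc (0 : ℝ) 1 := by
  unfold connProb
  split_ifs
  · simp
  · exact div_mem_Icc hd hdn

lemma connProb_relabel (σ : Equiv.Perm (Fin n)) (e : Pair n) :
    connProb n d σ (relabel σ e) = if e.1 = e.2 then 1 else d / n := by
  simp [connProb, mem_matching, relabel_apply]

instance isProbabilityMeasure_edgeLaw (P : Measure X) [IsProbabilityMeasure P]
    (G : Finset (Pair n)) (e : Pair n) : IsProbabilityMeasure
      (if e ∈ G then P.map Sum.inl else Measure.dirac (Sum.inr ()) : Measure (X ⊕ Unit)) := by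
  split_ifs
  · exact Measure.isProbabilityMeasure_map measurable_inl.aemeasurable
  · infer_instance

instance isProbabilityMeasure_weightLaw (P : Measure X) [IsProbabilityMeasure P]
    (G : Finset (Pair n)) : IsProbabilityMeasure (weightLaw P G) := by
  unfold weightLaw; infer_instance

instance isFiniteMeasure_plantedLaw (P : Measure X) [IsProbabilityMeasure P] :
    IsFiniteMeasure (plantedLaw P) := by
  unfold plantedLaw; infer_instance

instance isFiniteMeasure_unplantedLaw (P : Measure X) [IsProbabilityMeasure P] :
    IsFiniteMeasure (unplantedLaw n d P) := by
  unfold unplantedLaw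
  have h1 := Measure.smul_finite (P.map (Sum.inl : X → X ⊕ Unit))
    (ENNReal.ofReal_ne_top (r := d / n))
  have h2 := Measure.smul_finite (Measure.dirac (Sum.inr () : X ⊕ Unit))
    (ENNReal.ofReal_ne_top (r := 1 - d / n))
  infer_instance

/-- Expanding the product of two-point mixtures amounts to drawing the connected pairs first and the
weights afterwards. Because planted and unplanted weights have the same law, `weightLaw P G` does
not involve `σ`. -/
lemma observationLaw_eq_sum (P : Measure X) [IsProbabilityMeasure P] (hd : 0 ≤ d) (hdn : d ≤ n)
    (σ : Equiv.Perm (Fin n)) :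
    observationLaw n d P P (matching σ) =
      ∑ G, ENNReal.ofReal (bernWeight (connProb n d σ) G) • weightLaw P G := by
  classical
  unfold observationLaw
  have hfin : ∀ e : Pair n, IsFiniteMeasure
      (if e ∈ matching σ then plantedLaw P else unplantedLaw n d P) := by
    intro e; split_ifs <;> infer_instance
  have hI := fun e => connProb_mem_Icc hd hdn σ e
  convert Measure.pi_eq (μ := fun e : Pair n =>
    if e ∈ matching σ then plantedLaw P else unplantedLaw n d P) ?_ using 1
  intro s hs
  have hedge : ∀ e, (if e ∈ matching σ then plantedLaw P else unplantedLaw n d P) (s e) =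
      ENNReal.ofReal (connProb n d σ e) * P.map Sum.inl (s e) +
        ENNReal.ofReal (1 - connProb n d σ e) * Measure.dirac (Sum.inr ()) (s e) := by
    intro e
    unfold connProb
    split_ifs
    · simp [plantedLaw]
    · simp [unplantedLaw]
  simp only [hedge]
  rw [Finset.prod_add, Finset.powerset_univ, Measure.finsetSum_apply]
  refine Finset.sum_congr rfl fun G _ => ?_
  rw [Measure.smul_apply, weightLaw, Measure.pi_pi, bernWeight, smul_eq_mul,
    ENNReal.ofReal_prod_of_nonneg, ← Finset.prod_mul_distrib]
  · have : ∀ e : Pair n, (ENNReal.ofReal (if e ∈ G then connProb n d σ e else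
        1 - connProb n d σ e) * (if e ∈ G then P.map Sum.inl else Measure.dirac (Sum.inr ())) (s e))
        = if e ∈ G then ENNReal.ofReal (connProb n d σ e) * P.map Sum.inl (s e) else
          ENNReal.ofReal (1 - connProb n d σ e) * Measure.dirac (Sum.inr ()) (s e) := by
      intro e; split_ifs <;> rfl
    simp only [this]
    rw [Finset.prod_ite]
    congr 1
    · exact Finset.prod_congr (by ext; simp) fun _ _ => rfl
    · exact Finset.prod_congr (by ext; simp) fun _ _ => rfl
  · intro e _
    split_ifs
    · exact (hI e).1
    · linarith [(hI e).2]

lemma integrable_loss {μ : Measure (Observation n X)} [IsFiniteMeasure μ]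
    {Mhat : Observation n X → Finset (Pair n)} (hM : Measurable Mhat) (M : Finset (Pair n)) :
    Integrable (fun w => loss M (Mhat w)) μ := by
  have hmeas : Measurable fun w => loss M (Mhat w) :=
    (measurable_of_countable (fun M' => loss M M')).comp hM
  refine Integrable.of_bound hmeas.aestronglyMeasurable
    (∑ M' : Finset (Pair n), loss M M') (ae_of_all _ fun w => ?_)
  rw [Real.norm_of_nonneg (loss_nonneg _ _)]
  exact Finset.single_le_sum (f := fun M' => loss M M') (fun _ _ => loss_nonneg _ _)
    (Finset.mem_univ (Mhat w))

lemma avgError_eq (P : Measure X) [IsProbabilityMeasure P] (hd : 0 ≤ d) (hdn : d ≤ n)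
    {Mhat : Observation n X → Finset (Pair n)} (hM : Measurable Mhat) :
    avgError n d P P Mhat = (∑ σ : Equiv.Perm (Fin n), bernExp (connProb n d σ) fun G =>
      ∫ w, loss (matching σ) (Mhat w) ∂(weightLaw P G)) / (n.factorial : ℝ) := by
  unfold avgError
  congr 1
  refine Finset.sum_congr rfl fun σ _ => ?_
  rw [observationLaw_eq_sum P hd hdn σ, integral_finsetSum_measure, bernExp]
  · refine Finset.sum_congr rfl fun G _ => ?_
    rw [integral_smul_measure, ENNReal.toReal_ofReal (bernWeight_nonneg
      (fun e => connProb_mem_Icc hd hdn σ e) G), smul_eq_mul]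
  · intro G _
    exact (integrable_loss hM _).smul_measure ENNReal.ofReal_ne_top

lemma avgError_nonneg (P : Measure X) (Mhat : Observation n X → Finset (Pair n)) :
    0 ≤ avgError n d P P Mhat :=
  div_nonneg (Finset.sum_nonneg fun _ _ => integral_nonneg fun _ => loss_nonneg _ _)
    (Nat.cast_nonneg _)

/-- An estimator that finds a perfect matching among the connected pairs has a small error. -/
lemma avgError_le_of_forall (P : Measure X) [IsProbabilityMeasure P] (hd : 0 ≤ d) (hdn : d ≤ n)
    {Mhat : Observation n X → Finset (Pair n)} (hM : Measurable Mhat)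
    (hPM : ∀ G : Finset (Pair n), (perfectMatchings G).Nonempty → ∀ᵐ w ∂(weightLaw P G),
      ∃ τ ∈ perfectMatchings G, Mhat w = matching τ)
    {f : Finset (Pair n) → ℝ} (hf : ∀ A, ∀ π : Equiv.Perm (Fin n),
      (∀ i, π i ≠ i → (i, π i) ∈ A) → (π.support.card : ℝ) ≤ f A)
    {b : ℝ} (hb : bernExp (fun e : Pair n => if e.1 = e.2 then 1 else d / n) f ≤ b) :
    avgError n d P P Mhat ≤ 2 / n * b := by
  rw [avgError_eq P hd hdn hM, div_le_iff₀ (by positivity)]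
  refine (Finset.sum_le_card_nsmul _ _ (2 / n * b) fun σ _ => ?_).trans ?_
  · refine (bernExp_mono_of_subset (fun e => connProb_mem_Icc hd hdn σ e)
      (g := fun G => 2 / n * f (G.map (relabel σ⁻¹).toEmbedding)) fun G hG => ?_).trans ?_
    · have hσG : σ ∈ perfectMatchings G := mem_perfectMatchings.2 fun i => hG _ (by
        rw [connProb, if_pos (mem_matching.2 rfl)])
      have hle : ∀ᵐ w ∂(weightLaw P G), loss (matching σ) (Mhat w) ≤
          2 / n * f (G.map (relabel σ⁻¹).toEmbedding) := by
        filter_upwards [hPM G ⟨σ, hσG⟩] with w hw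
        obtain ⟨τ, hτ, hw⟩ := hw
        rw [hw, loss_matching, mul_div_right_comm]
        gcongr
        refine hf _ _ fun i _ => ?_
        rw [Equiv.Perm.mul_apply, mem_map_relabel]
        exact mem_perfectMatchings.1 hτ i
      calc _ ≤ ∫ _, 2 / n * f (G.map (relabel σ⁻¹).toEmbedding) ∂(weightLaw P G) :=
            integral_mono_ae (integrable_loss hM _) (integrable_const _) hle
        _ = _ := by simp
    · rw [bernExp_const_mul]
      gcongr
      rw [bernExp_map _ _ (relabel σ)]
      refine le_trans (le_of_eq ?_) hb
      congr 1
      · funext e; exact connProb_relabel σ e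
      · funext A
        congr 1
        rw [Finset.map_map]
        convert Finset.map_refl using 2
        ext e <;> simp [relabel_apply]
  · rw [Finset.card_univ, Fintype.card_perm, Fintype.card_fin, nsmul_eq_mul, mul_comm]

/-- The likelihood of `G` differs from a quantity free of `σ` by the constant factor `(d / n) ^ n`:
all perfect matchings contained in `G` are equally likely. -/
lemma bernWeight_connProb (σ : Equiv.Perm (Fin n)) {G : Finset (Pair n)}
    (hσ : σ ∈ perfectMatchings G) :
    bernWeight (connProb n d σ) G * (d / n) ^ n = bernWeight (fun _ => d / n) G := by
  have h : ∏ e : Pair n, (if e ∈ matching σ then d / n else 1) = (d / n) ^ n := by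
    rw [Finset.prod_ite_mem, Finset.univ_inter, Finset.prod_const, card_matching]
  rw [← h, bernWeight, bernWeight, ← Finset.prod_mul_distrib]
  refine Finset.prod_congr rfl fun e _ => ?_
  unfold connProb
  by_cases he : e ∈ matching σ
  · have : e ∈ G := matching_subset_iff.2 (mem_perfectMatchings.1 hσ) he
    simp [he, this]
  · simp [he]

lemma bernWeight_connProb_eq_zero (σ : Equiv.Perm (Fin n)) {G : Finset (Pair n)}
    (hσ : σ ∉ perfectMatchings G) : bernWeight (connProb n d σ) G = 0 := by
  rw [mem_perfectMatchings] at hσ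
  push Not at hσ
  obtain ⟨i, hi⟩ := hσ
  refine Finset.prod_eq_zero (Finset.mem_univ (i, σ i)) ?_
  rw [if_neg hi, connProb, if_pos (mem_matching.2 rfl), sub_self]

/-- The posterior distribution of the planted matching is uniform on the perfect matchings of the
observed graph, which bounds the error of every estimator from below. -/
lemma le_avgError (P : Measure X) [IsProbabilityMeasure P] (hd : 0 < d) (hdn : d ≤ n)
    {Mhat : Observation n X → Finset (Pair n)} (hM : Measurable Mhat) {b : ℝ}
    (hb : b ≤ bernExp (fun e : Pair n => if e.1 = e.2 then 1 else d / n) fun A =>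
      (∑ π ∈ perfectMatchings A, (π.support.card : ℝ)) / (n * (perfectMatchings A).card)) :
    b ≤ avgError n d P P Mhat := by
  have hn : (0 : ℝ) < n := hd.trans_le hdn
  have hp : (0 : ℝ) < d / n := by positivity
  rw [avgError_eq P hd.le hdn hM, le_div_iff₀ (by positivity)]
  set g : Equiv.Perm (Fin n) → Finset (Pair n) → ℝ := fun σ G =>
    (∑ τ ∈ perfectMatchings G, loss (matching σ) (matching τ)) /
      (2 * (perfectMatchings G).card) with hg
  -- Relabelling by `σ` moves the planted matching to the identity; the `2` in `g` cancels the `2`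
  -- in `loss_matching`.
  have h1 : ∀ σ, b ≤ bernExp (connProb n d σ) (g σ) := by
    intro σ
    refine hb.trans (le_of_eq ?_)
    rw [bernExp_map _ (g σ) (relabel σ)]
    congr 1
    · funext e; exact (connProb_relabel σ e).symm
    · funext A
      have hbij : perfectMatchings (A.map (relabel σ).toEmbedding) =
          (perfectMatchings A).map (Equiv.mulLeft σ).toEmbedding := by
        ext τ
        rw [Finset.mem_map_equiv, Equiv.mulLeft_symm_apply]
        change _ ↔ σ⁻¹ * τ ∈ _
        rw [← mem_perfectMatchings_map_relabel (σ := σ) (π := σ⁻¹ * τ), mul_inv_cancel_left]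
      simp only [hg, hbij, Finset.sum_map, Finset.card_map, Equiv.coe_toEmbedding,
        Equiv.coe_mulLeft, loss_matching, inv_mul_cancel_left]
      rw [← Finset.sum_div, ← Finset.mul_sum, div_div, mul_left_comm, mul_div_mul_left _ _ two_ne_zero]
  -- Bayes' rule: after exchanging the sums, every `σ` contained in a given `G` has the same weight,
  -- and `sum_loss_ge` applies for each observation.
  have h2 : ∑ σ, bernExp (connProb n d σ) (g σ) ≤ ∑ σ : Equiv.Perm (Fin n),
      bernExp (connProb n d σ) fun G => ∫ w, loss (matching σ) (Mhat w) ∂(weightLaw P G) := by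
    simp only [bernExp]
    rw [Finset.sum_comm, Finset.sum_comm (s := Finset.univ (α := Equiv.Perm (Fin n)))]
    refine Finset.sum_le_sum fun G _ => ?_
    have hw : ∀ h : Equiv.Perm (Fin n) → ℝ, ∑ σ, bernWeight (connProb n d σ) G * h σ =
        bernWeight (fun _ => d / n) G / (d / n) ^ n * ∑ σ ∈ perfectMatchings G, h σ := by
      intro h
      rw [Finset.mul_sum, ← Finset.sum_subset (Finset.subset_univ (perfectMatchings G))]
      · refine Finset.sum_congr rfl fun σ hσ => ?_
        rw [← bernWeight_connProb σ hσ, mul_div_cancel_right₀ _ (by positivity)]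
      · intro σ _ hσ
        rw [bernWeight_connProb_eq_zero σ hσ, zero_mul]
    rw [hw, hw]
    refine mul_le_mul_of_nonneg_left ?_ (div_nonneg
      (bernWeight_nonneg (fun _ => div_mem_Icc hd.le hdn) G) (by positivity))
    rw [← integral_finsetSum _ fun σ _ => integrable_loss hM _]
    calc _ = ∫ _, ∑ σ ∈ perfectMatchings G, g σ G ∂(weightLaw P G) := by simp
      _ ≤ _ := integral_mono (integrable_const _)
          (integrable_finsetSum _ fun σ _ => integrable_loss hM _)
          fun w => sum_loss_ge G (Mhat w)
  calc b * n.factorial = ∑ _σ : Equiv.Perm (Fin n), b := by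
        rw [Finset.sum_const, Finset.card_univ, Fintype.card_perm, Fintype.card_fin, nsmul_eq_mul,
          mul_comm]
    _ ≤ _ := (Finset.sum_le_sum fun σ _ => h1 σ).trans h2

end Observation

/-! ### Betting strategies against few successes. -/

section Tests

lemma le_prod_ite {E : Type*} [DecidableEq E] {α β : ℝ} (hα : 0 < α) (hα1 : α ≤ 1) (hβ : 1 ≤ β) (A B : Finset E) {K : ℕ}
    (hK : (B ∩ A).card ≤ K) :
    α ^ K * β ^ (B.card - K) ≤ ∏ e ∈ B, if e ∈ A then α else β := by
  rw [Finset.prod_ite, Finset.prod_const, Finset.prod_const, Finset.filter_mem_eq_inter,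
    Finset.filter_notMem_eq_sdiff]
  have h : (B \ A).card + (B ∩ A).card = B.card := Finset.card_sdiff_add_card_inter B A
  refine mul_le_mul (pow_le_pow_of_le_one hα.le hα1 hK) (pow_le_pow_right₀ hβ (by omega))
    (by positivity) (by positivity)

variable {E : Type*} [Fintype E] [DecidableEq E]

/-- A nonnegative function of the random set with mean at most one that does not depend on the
elements outside `S`. -/
def IsTest (c : E → ℝ) (S : Set E) (w : Finset E → ℝ) : Prop :=
  (∀ A, 0 ≤ w A) ∧ (∀ e ∉ S, ∀ A, w (insert e A) = w A) ∧ bernExp c w ≤ 1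

lemma isTest_one (c : E → ℝ) (S : Set E) : IsTest c S fun _ => 1 :=
  ⟨fun _ => zero_le_one, fun _ _ _ => rfl, (bernExp_const c 1).le⟩

lemma IsTest.mono {c : E → ℝ} {S S' : Set E} {w : Finset E → ℝ} (h : IsTest c S w)
    (hS : S ⊆ S') : IsTest c S' w :=
  ⟨h.1, fun e he => h.2.1 e fun h' => he (hS h'), h.2.2⟩

/-- Querying a fresh element and continuing with a test that may depend on the answer. -/
lemma IsTest.query {c : E → ℝ} {S : Set E} {w₁ w₀ : Finset E → ℝ} {e : E} {α β : ℝ}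
    (hce : c e ∈ Set.Icc (0 : ℝ) 1) (he : e ∈ S) (h₁ : IsTest c (S \ {e}) w₁)
    (h₀ : IsTest c (S \ {e}) w₀) (hα : 0 ≤ α) (hβ : 0 ≤ β) (h : c e * α + (1 - c e) * β ≤ 1) :
    IsTest c S fun A => if e ∈ A then α * w₁ A else β * w₀ A := by
  refine ⟨fun A => ?_, fun x hx A => ?_, ?_⟩
  · dsimp only
    split_ifs
    · exact mul_nonneg hα (h₁.1 A)
    · exact mul_nonneg hβ (h₀.1 A)
  · have hxe : e ≠ x := fun h' => hx (h' ▸ he)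
    have hx' : x ∉ S \ {e} := fun h' => hx h'.1
    simp only [Finset.mem_insert, hxe, false_or, h₁.2.1 x hx', h₀.2.1 x hx']
  · have hig : e ∉ S \ {e} := fun h' => h'.2 rfl
    rw [bernExp_resample c _ e]
    simp only [Finset.mem_insert_self, Finset.notMem_erase, if_true, if_false,
      h₁.2.1 e hig, apply_erase_of_insert (h₀.2.1 e hig)]
    rw [bernExp_add, bernExp_const_mul, bernExp_const_mul, bernExp_const_mul, bernExp_const_mul]
    have h1 : c e * (α * bernExp c w₁) ≤ c e * (α * 1) :=
      mul_le_mul_of_nonneg_left (mul_le_mul_of_nonneg_left h₁.2.2 hα) hce.1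
    have h2 : (1 - c e) * (β * bernExp c w₀) ≤ (1 - c e) * (β * 1) :=
      mul_le_mul_of_nonneg_left (mul_le_mul_of_nonneg_left h₀.2.2 hβ) (by linarith [hce.2])
    linarith

/-- Querying all elements of `B`. -/
lemma isTest_prod {c : E → ℝ} (hc : ∀ e, c e ∈ Set.Icc (0 : ℝ) 1) {α β : ℝ} (hα : 0 ≤ α)
    (hβ : 0 ≤ β) (B : Finset E) (h : ∀ e ∈ B, c e * α + (1 - c e) * β ≤ 1) :
    IsTest c (B : Set E) fun A => ∏ e ∈ B, if e ∈ A then α else β := by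
  induction B using Finset.induction_on with
  | empty => simpa using isTest_one c ∅
  | insert a B ha ih =>
    have ih' := (ih fun e he => h e (Finset.mem_insert_of_mem he)).mono
      (S' := (↑(insert a B) : Set E) \ {a}) fun x hx =>
        ⟨by simpa using Or.inr hx, fun h' => ha (h' ▸ hx)⟩
    convert IsTest.query (hc a) (by simp) ih' ih' hα hβ (h a (Finset.mem_insert_self _ _))
      using 2 with A
    rw [Finset.prod_insert ha]
    split_ifs <;> rfl

/-- Markov's inequality: a test is rarely large. -/
lemma bernExp_ind_le {c : E → ℝ} (hc : ∀ e, c e ∈ Set.Icc (0 : ℝ) 1) {S : Set E}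
    {w : Finset E → ℝ} (hw : IsTest c S w) {b : ℝ} (hb : 0 < b) :
    bernExp c (fun A => ind (b ≤ w A)) ≤ b⁻¹ := by
  calc _ ≤ bernExp c fun A => b⁻¹ * w A := bernExp_mono hc fun A =>
        ind_le_of_imp (mul_nonneg (inv_nonneg.2 hb.le) (hw.1 A)) fun h => by
          rw [inv_mul_eq_div, one_le_div hb]; exact h
    _ = b⁻¹ * bernExp c w := bernExp_const_mul _ _ _
    _ ≤ b⁻¹ * 1 := mul_le_mul_of_nonneg_left hw.2.2 (inv_nonneg.2 hb.le)
    _ = b⁻¹ := mul_one _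

end Tests

/-! ### Depth-first search as a betting game. -/

section DepthFirstSearch

variable {V : Type*} [Fintype V] [DecidableEq V]

/-- The logarithm of the guaranteed value of the test that accompanies the depth-first search. The
stack lists the vertices of the current path, last vertex first, with the targets already queried;
`T` is the set of unvisited vertices. -/
noncomputable def dfsPotential (y z : ℝ) (τ ℓ : ℕ) (st : List (V × Finset V)) (T : Finset V) : ℝ :=
  z * (τ * (T.card - τ + st.length - ℓ) - (st.map fun p => p.2.card).sum) -
    (y + z) * (T.card - τ)

/-- Depth-first search: if `F` holds, then either the search meets exponentially few arcs, or it
finds a path of length `ℓ` whose backward arcs, which are still unqueried, are exceptional. -/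
lemma exists_dfs_tests {c : V × V → ℝ} (hc : ∀ e, c e ∈ Set.Icc (0 : ℝ) 1) {y z : ℝ} (hy : 0 ≤ y)
    (hz : 0 ≤ z)
    (hq : ∀ u v : V, u ≠ v → c (u, v) * Real.exp (-y) + (1 - c (u, v)) * Real.exp z ≤ 1)
    (τ ℓ : ℕ) (b : ℝ) (U : Finset V) (F : Finset (V × V) → Prop)
    (hfin : ∀ (l : List V) (S : Set (V × V)), l.Nodup → l.length = ℓ → (∀ x ∈ l, x ∈ U) →
      l.Pairwise (fun x y => (x, y) ∈ S) →
      ∃ w, IsTest c S w ∧ ∀ A, l.IsChain (fun x y => (y, x) ∈ A) → F A → b ≤ w A)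
    (N : ℕ) :
    ∀ (st : List (V × Finset V)) (T : Finset V) (S : Set (V × V)),
      T.card * (Fintype.card V + 2) + (st.map fun p => Fintype.card V + 1 - p.2.card).sum ≤ N →
      st.length ≤ ℓ → τ ≤ T.card → T ⊆ U → (∀ p ∈ st, p.1 ∈ U ∧ p.1 ∉ T) →
      (st.map Prod.fst).Nodup →
      (∀ p ∈ st, ∀ t ∈ T, t ∉ p.2 → (p.1, t) ∈ S) →
      (∀ t ∈ T, ∀ x, x ≠ t → (t, x) ∈ S) →
      (st.map Prod.fst).Pairwise (fun x y => (x, y) ∈ S) →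
      ∃ w₁ w₂, IsTest c S w₁ ∧ IsTest c S w₂ ∧
        ∀ A, (st.map Prod.fst).IsChain (fun x y => (y, x) ∈ A) → F A →
          Real.exp (dfsPotential y z τ ℓ st T) ≤ w₁ A ∨ b ≤ w₂ A := by
  -- `N` bounds a quantity that drops at each move: visiting a vertex removes `Fintype.card V + 2`
  -- and adds `Fintype.card V + 1` for its stack entry, a query removes one, and an entry always
  -- counts at least one. `S` is the set of pairs not yet queried.
  induction N with
  | zero =>
    intro st T S hN hlen hτ hTU hst hnd h1 h2 h3
    have hT : T = ∅ := by
      rw [← Finset.card_eq_zero]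
      have : T.card * (Fintype.card V + 2) = 0 := by omega
      simpa using this
    subst hT
    have hst0 : st = [] := by
      rcases st with _ | ⟨⟨u, Q⟩, rest⟩
      · rfl
      · have := Finset.card_le_univ Q
        simp only [List.map_cons, List.sum_cons] at hN
        omega
    subst hst0
    refine ⟨_, _, isTest_one c S, isTest_one c S, fun A _ _ => Or.inl ?_⟩
    have hτ0 : τ = 0 := by simpa using hτ
    subst hτ0
    simp [dfsPotential]
  | succ N ih =>
    intro st T S hN hlen hτ hTU hst hnd h1 h2 h3
    rcases hlen.eq_or_lt with hlen' | hlen'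
    · obtain ⟨w, hw, hwA⟩ := hfin (st.map Prod.fst) S hnd (by simpa using hlen')
        (fun x hx => by
          obtain ⟨p, hp, rfl⟩ := List.mem_map.1 hx
          exact (hst p hp).1) h3
      exact ⟨_, w, isTest_one c S, hw, fun A hA hF => Or.inr (hwA A hA hF)⟩
    rcases hτ.eq_or_lt with hτ' | hτ'
    -- The search stops with `τ` unvisited vertices. The potential is then nonpositive, so no
    -- further bets are needed.
    · refine ⟨_, _, isTest_one c S, isTest_one c S, fun A _ _ => Or.inl ?_⟩
      rw [Real.exp_le_one_iff, dfsPotential, ← hτ', sub_self, mul_zero, sub_zero]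
      have h4 : (st.length : ℝ) ≤ ℓ := by exact_mod_cast hlen
      have h5 : (0 : ℝ) ≤ (st.map fun p => p.2.card).sum := Nat.cast_nonneg _
      have h6 : (τ : ℝ) * (0 + st.length - ℓ) ≤ 0 :=
        mul_nonpos_of_nonneg_of_nonpos (Nat.cast_nonneg _) (by linarith)
      exact mul_nonpos_of_nonneg_of_nonpos hz (by linarith)
    have hcard : ∀ t ∈ T, (T.erase t).card + 1 = T.card := fun t ht =>
      Finset.card_erase_add_one ht
    rcases st with _ | ⟨⟨u, Q⟩, rest⟩
    · obtain ⟨t, ht⟩ : T.Nonempty := Finset.card_pos.1 (by omega)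
      have hc1 := hcard t ht
      obtain ⟨w₁, w₂, hw₁, hw₂, hw⟩ := ih [(t, ∅)] (T.erase t) S
        (by
          simp only [List.map_cons, List.map_nil, List.sum_cons, List.sum_nil,
            Finset.card_empty] at hN ⊢
          have : T.card * (Fintype.card V + 2) =
              (T.erase t).card * (Fintype.card V + 2) + (Fintype.card V + 2) := by
            rw [← hc1]; ring
          omega)
        (by simp only [List.length_nil, List.length_singleton] at hlen' ⊢; omega) (by omega)
        ((Finset.erase_subset _ _).trans hTU)
        (by simpa using hTU ht) (by simp)
        (by
          simp only [List.mem_singleton, forall_eq]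
          exact fun x hx _ => h2 t ht x (Finset.ne_of_mem_erase hx))
        (fun x hx => h2 x (Finset.mem_of_mem_erase hx)) (by simp)
      refine ⟨w₁, w₂, hw₁, hw₂, fun A _ hF => (hw A (by simp) hF).imp_left fun h => le_trans ?_ h⟩
      rw [Real.exp_le_exp, dfsPotential, dfsPotential, ← hc1]
      simp only [List.map_cons, List.map_nil, List.sum_cons, List.sum_nil, Finset.card_empty,
        List.length_nil, List.length_singleton]
      push_cast
      linarith
    simp only [List.map_cons, List.nodup_cons, List.pairwise_cons] at hnd h3
    have huT : u ∉ T := (hst (u, Q) (by simp)).2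
    have hrest : ∀ p ∈ rest, p.1 ∈ U ∧ p.1 ∉ T := fun p hp => hst p (by simp [hp])
    have hpu : ∀ p ∈ rest, p.1 ≠ u := fun p hp h => hnd.1 (h ▸ List.mem_map_of_mem hp)
    have hmem : ∀ x ∈ rest.map Prod.fst, x ∉ T := by
      intro x hx
      obtain ⟨p, hp, rfl⟩ := List.mem_map.1 hx
      exact (hrest p hp).2
    have hQ := Finset.card_le_univ Q
    by_cases hTQ : T ⊆ Q
    -- The top of the stack has queried all unvisited vertices and is popped. It made at least `τ`
    -- queries, so the potential does not drop.
    · obtain ⟨w₁, w₂, hw₁, hw₂, hw⟩ := ih rest T S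
        (by simp only [List.map_cons, List.sum_cons] at hN; omega)
        (by simp only [List.length_cons] at hlen; omega) hτ hTU hrest hnd.2
        (fun p hp => h1 p (by simp [hp])) h2 h3.2
      refine ⟨w₁, w₂, hw₁, hw₂, fun A hA hF => (hw A (List.IsChain.tail hA) hF).imp_left
        fun h => le_trans ?_ h⟩
      rw [Real.exp_le_exp, dfsPotential, dfsPotential]
      simp only [List.map_cons, List.sum_cons, List.length_cons]
      push_cast
      have : (τ : ℝ) ≤ Q.card := by exact_mod_cast hτ.trans (Finset.card_le_card hTQ)
      have := mul_le_mul_of_nonneg_left this hz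
      linarith
    · obtain ⟨t, ht, htQ⟩ := Finset.not_subset.1 hTQ
      have hc1 := hcard t ht
      have htu : t ≠ u := fun h => huT (h ▸ ht)
      have hQt : (insert t Q).card = Q.card + 1 := Finset.card_insert_of_notMem htQ
      have hQt' := Finset.card_le_univ (insert t Q)
      have huU : u ∈ U := (hst (u, Q) (by simp)).1
      have hpt : ∀ p ∈ rest, p.1 ≠ t := fun p hp h => (hrest p hp).2 (h ▸ ht)
      have hpair : (rest.map Prod.fst).Pairwise fun x y => (x, y) ∈ S \ {(u, t)} := by
        rw [List.pairwise_map] at h3 ⊢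
        refine List.Pairwise.imp_of_mem ?_ h3.2
        intro p q _ hq h
        exact ⟨h, fun h' => hpt q hq (congrArg Prod.snd h')⟩
      have hpair' : ∀ x ∈ rest.map Prod.fst, (u, x) ∈ S \ {(u, t)} := fun x hx =>
        ⟨h3.1 x hx, fun h' => hmem x hx ((Prod.mk.inj (Set.mem_singleton_iff.1 h')).2 ▸ ht)⟩
      have hu1 : ∀ x ∈ T, x ∉ insert t Q → (u, x) ∈ S \ {(u, t)} := fun x hx hxQ =>
        ⟨h1 (u, Q) (by simp) x hx fun h => hxQ (Finset.mem_insert_of_mem h), fun h' =>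
          hxQ ((Prod.mk.inj (Set.mem_singleton_iff.1 h')).2 ▸ Finset.mem_insert_self _ _)⟩
      have hp1 : ∀ p ∈ rest, ∀ x ∈ T, x ∉ p.2 → (p.1, x) ∈ S \ {(u, t)} := fun p hp x hx hxp =>
        ⟨h1 p (by simp [hp]) x hx hxp, fun h' => hpu p hp (congrArg Prod.fst h')⟩
      have ht1 : ∀ x ∈ T, ∀ x', x' ≠ x → (x, x') ∈ S \ {(u, t)} := fun x hx x' hx' =>
        ⟨h2 x hx x' hx', fun h' => huT ((Prod.mk.inj (Set.mem_singleton_iff.1 h')).1 ▸ hx)⟩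
      -- Strategy if the arc `(u, t)` is present: `t` is pushed.
      obtain ⟨v₁, v₂, hv₁, hv₂, hv⟩ := ih ((t, ∅) :: (u, insert t Q) :: rest) (T.erase t)
        (S \ {(u, t)})
        (by
          simp only [List.map_cons, List.sum_cons, Finset.card_empty, hQt] at hN ⊢
          have : T.card * (Fintype.card V + 2) =
              (T.erase t).card * (Fintype.card V + 2) + (Fintype.card V + 2) := by
            rw [← hc1]; ring
          omega)
        (by simp only [List.length_cons] at hlen' ⊢; omega) (by omega)
        ((Finset.erase_subset _ _).trans hTU)
        (by
          simp only [List.mem_cons, forall_eq_or_imp]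
          exact ⟨⟨hTU ht, Finset.notMem_erase _ _⟩,
            ⟨huU, fun h => huT (Finset.mem_of_mem_erase h)⟩,
            fun p hp => ⟨(hrest p hp).1, fun h => (hrest p hp).2 (Finset.mem_of_mem_erase h)⟩⟩)
        (by
          simp only [List.map_cons, List.nodup_cons, List.mem_cons, not_or]
          exact ⟨⟨htu, fun h => hmem t h ht⟩, hnd⟩)
        (by
          simp only [List.mem_cons, forall_eq_or_imp]
          exact ⟨fun x hx _ => ht1 t ht x (Finset.ne_of_mem_erase hx),
            fun x hx hxQ => hu1 x (Finset.mem_of_mem_erase hx) hxQ,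
            fun p hp x hx => hp1 p hp x (Finset.mem_of_mem_erase hx)⟩)
        (fun x hx => ht1 x (Finset.mem_of_mem_erase hx))
        (by
          simp only [List.map_cons, List.pairwise_cons, List.mem_cons, forall_eq_or_imp]
          exact ⟨⟨ht1 t ht u htu.symm, fun x hx => ht1 t ht x fun h => hmem x hx (h ▸ ht)⟩,
            hpair', hpair⟩)
      -- Strategy if it is absent: `t` is only recorded as queried by `u`.
      obtain ⟨w₁, w₂, hw₁, hw₂, hw⟩ := ih ((u, insert t Q) :: rest) T (S \ {(u, t)})
        (by
          simp only [List.map_cons, List.sum_cons, hQt] at hN ⊢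
          omega)
        (by simpa only [List.length_cons] using hlen) hτ hTU
        (by
          simp only [List.mem_cons, forall_eq_or_imp]
          exact ⟨⟨huU, huT⟩, hrest⟩)
        (by simpa only [List.map_cons, List.nodup_cons] using hnd)
        (by
          simp only [List.mem_cons, forall_eq_or_imp]
          exact ⟨hu1, hp1⟩)
        ht1
        (by
          simp only [List.map_cons, List.pairwise_cons]
          exact ⟨hpair', hpair⟩)
      have hutS : (u, t) ∈ S := h1 (u, Q) (by simp) t ht htQ
      -- The first test bets on absence, and the potential changes by exactly `y` or `-z`. The
      -- second stakes nothing during the search (factor one), saving its bets for the backward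
      -- arcs.
      refine ⟨_, _, IsTest.query (hc (u, t)) hutS hv₁ hw₁ (Real.exp_pos _).le (Real.exp_pos _).le
        (hq u t htu.symm), IsTest.query (hc (u, t)) hutS hv₂ hw₂ zero_le_one zero_le_one
        (by linarith), fun A hA hF => ?_⟩
      simp only [one_mul]
      split_ifs with hutA
      · refine (hv A (by
          simp only [List.map_cons] at hA ⊢
          exact List.IsChain.cons_cons hutA hA) hF).imp_left fun h => ?_
        refine le_trans (le_of_eq ?_) (mul_le_mul_of_nonneg_left h (Real.exp_pos _).le)
        rw [← Real.exp_add]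
        congr 1
        rw [dfsPotential, dfsPotential, ← hc1]
        simp only [List.map_cons, List.sum_cons, List.length_cons, Finset.card_empty, hQt]
        push_cast
        ring
      · refine (hw A (by simpa only [List.map_cons] using hA) hF).imp_left fun h => ?_
        refine le_trans (le_of_eq ?_) (mul_le_mul_of_nonneg_left h (Real.exp_pos _).le)
        rw [← Real.exp_add]
        congr 1
        rw [dfsPotential, dfsPotential]
        simp only [List.map_cons, List.sum_cons, List.length_cons, hQt]
        push_cast
        ring

end DepthFirstSearch

/-! ### Backward arcs of a path and long cycles. -/

section Cycles

variable {V : Type*} [Fintype V] [DecidableEq V]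

/-- The cyclic permutations along arcs of `A` with support in `U` of size more than `D`. -/
noncomputable def longCycles (A : Finset (V × V)) (U : Finset V) (D : ℕ) : Finset (Equiv.Perm V) :=
  by classical exact Finset.univ.filter fun c =>
    c.IsCycle ∧ c.support ⊆ U ∧ D < c.support.card ∧ ∀ v ∈ c.support, (v, c v) ∈ A

lemma mem_longCycles {A : Finset (V × V)} {U : Finset V} {D : ℕ} {c : Equiv.Perm V} :
    c ∈ longCycles A U D ↔
      c.IsCycle ∧ c.support ⊆ U ∧ D < c.support.card ∧ ∀ v ∈ c.support, (v, c v) ∈ A := by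
  simp [longCycles]

/-- A path `l`, listed last vertex first, and an arc from `l[i]` back to `l[j]` form a cycle. -/
lemma exists_cycle_of_back_arc {A : Finset (V × V)} {l : List V} (hl : l.Nodup)
    (hch : l.IsChain fun x y => (y, x) ∈ A) {i j : ℕ} (hij : i < j) (hj : j < l.length)
    (hA : (l[i], l[j]) ∈ A) :
    ∃ c : Equiv.Perm V, c.IsCycle ∧ c.support.card = j + 1 - i ∧
      (∀ k (hk : k < l.length), l[k] ∈ c.support ↔ i ≤ k ∧ k ≤ j) ∧
      (∀ v ∈ c.support, v ∈ l) ∧ ∀ v ∈ c.support, (v, c v) ∈ A := by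
  set s : List V := (l.drop i).take (j + 1 - i) with hs
  have hlen : s.length = j + 1 - i := by simp [hs]; omega
  have hget : ∀ k (hk : k < s.length), s[k] = l[i + k]'(by omega) := by
    intro k hk
    simp [hs]
  have hnd : s.Nodup := (hl.sublist (List.drop_sublist _ _)).sublist (List.take_sublist _ _)
  have hcyc : s.formPerm.IsCycle := List.isCycle_formPerm hnd (by omega)
  have hsupp : s.formPerm.support = s.toFinset := by
    refine List.support_formPerm_of_nodup s hnd fun x hx => ?_
    rw [hx, List.length_singleton] at hlen
    omega
  have hmem : ∀ v, v ∈ s ↔ ∃ k, ∃ hk : k < l.length, (i ≤ k ∧ k ≤ j) ∧ l[k] = v := by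
    intro v
    rw [List.mem_iff_getElem]
    constructor
    · rintro ⟨k, hk, rfl⟩
      exact ⟨i + k, by omega, by omega, (hget k hk).symm⟩
    · rintro ⟨k, hk, hk', rfl⟩
      refine ⟨k - i, by omega, ?_⟩
      rw [hget]
      congr 1
      omega
  -- The list runs against the arcs, hence the inverse; it sends `l[i]` to `l[j]` along the backward
  -- arc.
  refine ⟨s.formPerm⁻¹, hcyc.inv, ?_, ?_, ?_, ?_⟩
  · rw [Equiv.Perm.support_inv, hsupp, List.toFinset_card_of_nodup hnd, hlen]
  · intro k hk
    rw [Equiv.Perm.support_inv, hsupp, List.mem_toFinset, hmem]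
    constructor
    · rintro ⟨k', hk', h, heq⟩
      rw [hl.getElem_inj_iff] at heq
      exact heq ▸ h
    · intro h; exact ⟨k, hk, h, rfl⟩
  · intro v hv
    rw [Equiv.Perm.support_inv, hsupp, List.mem_toFinset, hmem] at hv
    obtain ⟨k, hk, _, rfl⟩ := hv
    exact List.getElem_mem hk
  · intro v hv
    rw [Equiv.Perm.support_inv, hsupp, List.mem_toFinset, List.mem_iff_getElem] at hv
    obtain ⟨k, hk, rfl⟩ := hv
    rcases k with _ | k
    · have h0 : s.formPerm (s[s.length - 1]'(by omega)) = s[0] := by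
        rw [List.formPerm_apply_getElem s hnd (s.length - 1) (by omega)]
        congr 1
        rw [Nat.sub_add_cancel (by omega), Nat.mod_self]
      rw [← h0, Equiv.Perm.inv_def, Equiv.symm_apply_apply, h0, hget, hget]
      convert hA using 3 <;> omega
    · have h1 := List.formPerm_apply_lt_getElem s hnd k hk
      rw [← h1, Equiv.Perm.inv_def, Equiv.symm_apply_apply, h1, hget, hget]
      exact List.isChain_iff_getElem.1 hch (i + k) (by omega)

/-- Distinct backward arcs from the last `h` to the first `h` vertices of a path yield distinct long
cycles. -/
lemma card_back_arcs_le {A : Finset (V × V)} {U : Finset V} {l : List V} (hl : l.Nodup)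
    (hch : l.IsChain fun x y => (y, x) ∈ A) (hlU : ∀ x ∈ l, x ∈ U) {h D : ℕ}
    (hD : 2 * h + D ≤ l.length) :
    (((l.take h).toFinset ×ˢ (l.drop (l.length - h)).toFinset) ∩ A).card ≤
      (longCycles A U D).card := by
  have key : ∀ e ∈ ((l.take h).toFinset ×ˢ (l.drop (l.length - h)).toFinset) ∩ A,
      ∃ c ∈ longCycles A U D, ∃ i j, ∃ hj : j < l.length, ∃ hi : i < l.length, e = (l[i], l[j]) ∧
        i < j ∧ ∀ k (hk : k < l.length), l[k] ∈ c.support ↔ i ≤ k ∧ k ≤ j := by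
    rintro ⟨x, y⟩ he
    simp only [Finset.mem_inter, Finset.mem_product, List.mem_toFinset] at he
    obtain ⟨⟨hx, hy⟩, hA⟩ := he
    obtain ⟨i, hi, rfl⟩ := List.mem_iff_getElem.1 hx
    obtain ⟨j, hj, rfl⟩ := List.mem_iff_getElem.1 hy
    simp only [List.length_take, List.length_drop] at hi hj
    simp only [List.getElem_take, List.getElem_drop] at hA ⊢
    obtain ⟨c, hc1, hc2, hc3, hc4, hc5⟩ := exists_cycle_of_back_arc hl hch
      (i := i) (j := l.length - h + j) (by omega) (by omega) hA
    refine ⟨c, mem_longCycles.2 ⟨hc1, fun v hv => hlU v (hc4 v hv), by omega, hc5⟩, i, _,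
      by omega, by omega, rfl, by omega, hc3⟩
  choose! φ hφ hφ' using key
  -- The arc is recovered from its cycle: the support meets `l` exactly in the positions from `i` to
  -- `j`.
  refine Finset.card_le_card_of_injOn φ hφ fun e he e' he' hee => ?_
  obtain ⟨i, j, hj, hi, rfl, hij, hk⟩ := hφ' e he
  obtain ⟨i', j', hj', hi', rfl, hij', hk'⟩ := hφ' e' he'
  rw [hee] at hk
  have h1 := (hk i hi).2 ⟨le_rfl, hij.le⟩
  have h2 := (hk j hj).2 ⟨hij.le, le_rfl⟩
  have h3 := (hk' i' hi').2 ⟨le_rfl, hij'.le⟩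
  have h4 := (hk' j' hj').2 ⟨hij'.le, le_rfl⟩
  rw [hk'] at h1 h2
  rw [hk] at h3 h4
  obtain rfl : i = i' := by omega
  obtain rfl : j = j' := by omega
  rfl

/-- Few long cycles are exponentially unlikely. -/
lemma bernExp_few_cycles_le {c : V × V → ℝ} (hc : ∀ e, c e ∈ Set.Icc (0 : ℝ) 1) {y z p : ℝ}
    (hy : 0 ≤ y) (hz : 0 ≤ z)
    (hq : ∀ u v : V, u ≠ v → c (u, v) * Real.exp (-y) + (1 - c (u, v)) * Real.exp z ≤ 1)
    (hp0 : 0 ≤ p) (hp : ∀ u v : V, u ≠ v → p ≤ c (u, v))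
    (τ ℓ h D K : ℕ) (U : Finset V) (hτ : τ ≤ U.card) (hD : 2 * h + D ≤ ℓ) :
    bernExp c (fun A => ind ((longCycles A U D).card ≤ K)) ≤
      Real.exp ((y + z) * (U.card - τ) - z * τ * (U.card - τ - ℓ)) +
        ((1 / 2 : ℝ) ^ K * (1 + p / 2) ^ (h * h - K))⁻¹ := by
  have hb : 0 < (1 / 2 : ℝ) ^ K * (1 + p / 2) ^ (h * h - K) := by positivity
  obtain ⟨w₁, w₂, hw₁, hw₂, hw⟩ := exists_dfs_tests hc hy hz hq τ ℓ
    ((1 / 2 : ℝ) ^ K * (1 + p / 2) ^ (h * h - K)) U (fun A => (longCycles A U D).card ≤ K)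
    (by
      intro l S hl hlen hlU hS
      set B := (l.take h).toFinset ×ˢ (l.drop (l.length - h)).toFinset with hB
      have hlt : ∀ e ∈ B, e ∈ S ∧ e.1 ≠ e.2 := by
        rintro ⟨x, y⟩ he
        simp only [hB, Finset.mem_product, List.mem_toFinset] at he
        obtain ⟨hx, hy⟩ := he
        obtain ⟨i, hi, rfl⟩ := List.mem_iff_getElem.1 hx
        obtain ⟨j, hj, rfl⟩ := List.mem_iff_getElem.1 hy
        simp only [List.length_take, List.length_drop] at hi hj
        simp only [List.getElem_take, List.getElem_drop]
        refine ⟨List.pairwise_iff_getElem.1 hS _ _ _ _ (by omega), fun h' => ?_⟩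
        rw [hl.getElem_inj_iff] at h'
        omega
      have hcard : B.card = h * h := by
        rw [hB, Finset.card_product,
          List.toFinset_card_of_nodup (hl.sublist (List.take_sublist _ _)),
          List.toFinset_card_of_nodup (hl.sublist (List.drop_sublist _ _)),
          List.length_take, List.length_drop]
        congr 1 <;> omega
      -- Bets against the `h * h` backward arcs: factor `1 / 2` if present, `1 + p / 2` if absent.
      -- With at most `K` long cycles, at most `K` of these arcs are present.
      refine ⟨_, (isTest_prod hc (α := 1 / 2) (β := 1 + p / 2) (by norm_num) (by positivity) B
        fun e he => ?_).mono fun e he => (hlt e he).1, fun A hch hF => ?_⟩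
      · have h1 := hp e.1 e.2 (hlt e he).2
        rw [Prod.mk.eta] at h1
        nlinarith [(hc e).1, (hc e).2]
      · rw [← hcard]
        exact le_prod_ite (by norm_num) (by norm_num) (by linarith) A B
          ((card_back_arcs_le hl hch hlU (by omega)).trans hF))
    _ [] U Set.univ le_rfl (by simp) hτ subset_rfl (by simp) (by simp) (by simp) (by simp) (by simp)
  have hpot : dfsPotential y z τ ℓ ([] : List (V × Finset V)) U =
      -((y + z) * (U.card - τ) - z * τ * (U.card - τ - ℓ)) := by
    simp only [dfsPotential, List.map_nil, List.sum_nil, List.length_nil]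
    push_cast
    ring
  rw [hpot] at hw
  calc _ ≤ bernExp c (fun A =>
        ind (Real.exp (-((y + z) * (U.card - τ) - z * τ * (U.card - τ - ℓ))) ≤ w₁ A) +
        ind ((1 / 2 : ℝ) ^ K * (1 + p / 2) ^ (h * h - K) ≤ w₂ A)) := by
        refine bernExp_mono hc fun A => ind_le_of_imp (add_nonneg (ind_nonneg _) (ind_nonneg _))
          fun hF => ?_
        rcases hw A (by simp) hF with h' | h'
        · rw [ind_of_true h']; linarith [ind_nonneg
            ((1 / 2 : ℝ) ^ K * (1 + p / 2) ^ (h * h - K) ≤ w₂ A)]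
        · rw [ind_of_true h']; linarith [ind_nonneg
            (Real.exp (-((y + z) * (U.card - τ) - z * τ * (U.card - τ - ℓ))) ≤ w₁ A)]
    _ ≤ _ := by
        rw [bernExp_add]
        refine add_le_add ((bernExp_ind_le hc hw₁ (Real.exp_pos _)).trans (le_of_eq ?_))
          (bernExp_ind_le hc hw₂ hb)
        rw [← Real.exp_neg, neg_neg]

end Cycles

/-! ### Double counting of permutations with small and large support. -/

section Counting

variable {n : ℕ}

/-- If many long cycles remain after the removal of any small set of vertices, then permutations with
small support are in the minority. -/
lemma card_small_support_le {A : Finset (Pair n)} {m K : ℕ} (hK : n ≤ K * (m + 1))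
    (hA : ∀ S : Finset (Fin n), S.card ≤ m → K < (longCycles A Sᶜ m).card) :
    ((perfectMatchings A).filter fun π => π.support.card ≤ m).card ≤
      ((perfectMatchings A).filter fun π => ¬ π.support.card ≤ m).card := by
  classical
  set close := (perfectMatchings A).filter fun π => π.support.card ≤ m
  set far := (perfectMatchings A).filter fun π => ¬ π.support.card ≤ m
  have hcommute : ∀ π : Equiv.Perm (Fin n), ∀ c ∈ longCycles A π.supportᶜ m,
      ∀ i ∈ c.support, (π * c) i = c i := by
    intro π c hc i hi
    have h1 : c i ∈ c.support := Equiv.Perm.apply_mem_support.2 hi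
    have h2 := Finset.mem_compl.1 ((mem_longCycles.1 hc).2.1 h1)
    rw [Equiv.Perm.mul_apply, Equiv.Perm.notMem_support.1 h2]
  -- The cycle `c` avoids the support of `π`, so it is a cycle factor of `π * c`, and `π` is
  -- recovered from `π * c` and `c`.
  have h1 : (close.sigma fun π => longCycles A π.supportᶜ m).card ≤
      (far.sigma fun ρ => ρ.cycleFactorsFinset.filter fun c => m < c.support.card).card := by
    refine Finset.card_le_card_of_injOn (fun x => ⟨x.1 * x.2, x.2⟩) ?_ ?_
    · rintro ⟨π, c⟩ hx
      simp only [Finset.coe_sigma, Set.mem_sigma_iff, Finset.mem_coe] at hx ⊢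
      obtain ⟨hπ, hc⟩ := hx
      have hc' := mem_longCycles.1 hc
      have hfac : c ∈ (π * c).cycleFactorsFinset :=
        Equiv.Perm.mem_cycleFactorsFinset_iff.2
          ⟨hc'.1, fun i hi => (hcommute π c hc i hi).symm⟩
      refine ⟨Finset.mem_filter.2 ⟨mem_perfectMatchings.2 fun i => ?_, ?_⟩,
        Finset.mem_filter.2 ⟨hfac, hc'.2.2.1⟩⟩
      · by_cases hi : i ∈ c.support
        · rw [hcommute π c hc i hi]; exact hc'.2.2.2 i hi
        · rw [Equiv.Perm.mul_apply, Equiv.Perm.notMem_support.1 hi]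
          exact mem_perfectMatchings.1 (Finset.mem_filter.1 hπ).1 i
      · have := Finset.card_le_card (Equiv.Perm.mem_cycleFactorsFinset_support_le hfac)
        have := hc'.2.2.1
        omega
    · rintro ⟨π, c⟩ _ ⟨π', c'⟩ _ h
      simp only [Sigma.mk.injEq, heq_eq_eq] at h
      obtain ⟨h, rfl⟩ := h
      rw [mul_right_cancel h]
  rw [Finset.card_sigma, Finset.card_sigma] at h1
  have h2 : close.card * (K + 1) ≤ ∑ π ∈ close, (longCycles A π.supportᶜ m).card := by
    rw [← smul_eq_mul]
    exact Finset.card_nsmul_le_sum _ _ _ fun π hπ => hA _ (Finset.mem_filter.1 hπ).2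
  -- Cycle factors have disjoint supports, so at most `n / (m + 1)` of them have more than `m`
  -- points.
  have h3 : (m + 1) * ∑ ρ ∈ far, (ρ.cycleFactorsFinset.filter fun c => m < c.support.card).card ≤
      far.card * n := by
    rw [Finset.mul_sum, ← smul_eq_mul]
    refine Finset.sum_le_card_nsmul _ _ _ fun ρ _ => ?_
    calc _ ≤ ∑ c ∈ ρ.cycleFactorsFinset.filter fun c => m < c.support.card, c.support.card := by
          rw [mul_comm, ← smul_eq_mul]
          exact Finset.card_nsmul_le_sum _ _ _ fun c hc => (Finset.mem_filter.1 hc).2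
      _ ≤ ∑ c ∈ ρ.cycleFactorsFinset, c.support.card :=
          Finset.sum_le_sum_of_subset (Finset.filter_subset _ _)
      _ = ρ.support.card := by
          rw [← Equiv.Perm.sum_cycleType, Equiv.Perm.cycleType_def]
          rfl
      _ ≤ n := by simpa using Finset.card_le_univ ρ.support
  rcases Nat.eq_zero_or_pos n with hn | hn
  · have h4 : close.card * (K + 1) * (m + 1) ≤ far.card * n := by nlinarith
    rw [mul_eq_zero_of_right far.card hn] at h4
    have : close.card = 0 := by simpa using h4
    omega
  · have h4 : close.card * n ≤ far.card * n := by nlinarith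
    exact Nat.le_of_mul_le_mul_right h4 hn

lemma le_sum_support {A : Finset (Pair n)} {m K : ℕ} (hK : n ≤ K * (m + 1))
    (hA : ∀ S : Finset (Fin n), S.card ≤ m → K < (longCycles A Sᶜ m).card) :
    ((m : ℝ) + 1) / 2 * (perfectMatchings A).card ≤
      ∑ π ∈ perfectMatchings A, (π.support.card : ℝ) := by
  have h1 := card_small_support_le hK hA
  have h2 := Finset.card_filter_add_card_filter_not (s := perfectMatchings A)
    (fun π : Equiv.Perm (Fin n) => π.support.card ≤ m)
  have h3 : ((perfectMatchings A).card : ℝ) ≤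
      2 * ((perfectMatchings A).filter fun π => ¬ π.support.card ≤ m).card := by
    exact_mod_cast (by omega : (perfectMatchings A).card ≤
      2 * ((perfectMatchings A).filter fun π => ¬ π.support.card ≤ m).card)
  calc _ ≤ ((m : ℝ) + 1) / 2 *
        (2 * ((perfectMatchings A).filter fun π => ¬ π.support.card ≤ m).card) := by gcongr
    _ = ((perfectMatchings A).filter fun π => ¬ π.support.card ≤ m).card • ((m : ℝ) + 1) := by
        rw [nsmul_eq_mul]; ring
    _ ≤ ∑ π ∈ (perfectMatchings A).filter fun π => ¬ π.support.card ≤ m,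
        (π.support.card : ℝ) :=
        Finset.card_nsmul_le_sum _ _ _ fun π hπ => by
          have := (Finset.mem_filter.1 hπ).2
          exact_mod_cast (by omega : m + 1 ≤ π.support.card)
    _ ≤ _ := Finset.sum_le_sum_of_subset_of_nonneg (Finset.filter_subset _ _)
        fun _ _ _ => Nat.cast_nonneg _

/-- Exponential counting: giving each set `S` the weight `(θ ^ 2) ^ S.card` yields total `(1 + θ ^
2) ^ Fintype.card V`, and each small set weighs at least `θ ^ (2 * m)`. The crude bound `θ ≥ exp
(-θ⁻¹)` suffices. -/
lemma card_small_sets_le {V : Type*} [Fintype V] [DecidableEq V] {m : ℕ} {θ : ℝ} (hθ : 0 < θ)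
    (hθ1 : θ ≤ 1) (hm : (m : ℝ) ≤ θ ^ 2 * Fintype.card V) :
    (((Finset.univ : Finset (Finset V)).filter fun S => S.card ≤ m).card : ℝ) ≤
      Real.exp (3 * θ * Fintype.card V) := by
  have h1 : ∑ S : Finset V, (θ ^ 2) ^ S.card = (θ ^ 2 + 1) ^ Fintype.card V := by
    have := Finset.sum_pow_mul_eq_add_pow (θ ^ 2) 1 (Finset.univ : Finset V)
    simpa using this
  have h2 : (((Finset.univ : Finset (Finset V)).filter fun S => S.card ≤ m).card : ℝ) *
      (θ ^ 2) ^ m ≤ (θ ^ 2 + 1) ^ Fintype.card V := by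
    rw [← h1, ← nsmul_eq_mul]
    refine (Finset.card_nsmul_le_sum _ _ _ fun S hS => ?_).trans
      (Finset.sum_le_univ_sum_of_nonneg fun S => by positivity)
    exact pow_le_pow_of_le_one (by positivity) (pow_le_one₀ hθ.le hθ1) (Finset.mem_filter.1 hS).2
  have h3 : Real.exp (-(2 * θ * Fintype.card V)) ≤ (θ ^ 2) ^ m := by
    have h4 : Real.exp (-θ⁻¹) ≤ θ := by
      rw [Real.exp_neg]
      refine inv_le_of_inv_le₀ hθ ?_
      linarith [Real.add_one_le_exp θ⁻¹]
    calc _ ≤ Real.exp (((2 * m : ℕ) : ℝ) * -θ⁻¹) := by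
          rw [Real.exp_le_exp]
          have : (m : ℝ) * θ⁻¹ ≤ θ * Fintype.card V := by
            rw [← div_eq_mul_inv, div_le_iff₀ hθ]
            linarith
          push_cast
          linarith
      _ = Real.exp (-θ⁻¹) ^ (2 * m) := by rw [Real.exp_nat_mul]
      _ ≤ θ ^ (2 * m) := by gcongr
      _ = (θ ^ 2) ^ m := pow_mul _ _ _
  have h4 : (θ ^ 2 + 1) ^ Fintype.card V ≤ Real.exp (θ * Fintype.card V) := by
    rw [mul_comm, Real.exp_nat_mul]
    have : θ ^ 2 + 1 ≤ Real.exp θ := by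
      have := Real.add_one_le_exp θ
      nlinarith
    gcongr
  have h5 : (((Finset.univ : Finset (Finset V)).filter fun S => S.card ≤ m).card : ℝ) *
      Real.exp (-(2 * θ * Fintype.card V)) ≤ Real.exp (θ * Fintype.card V) :=
    (mul_le_mul_of_nonneg_left h3 (Nat.cast_nonneg _)).trans (h2.trans h4)
  calc _ = (((Finset.univ : Finset (Finset V)).filter fun S => S.card ≤ m).card : ℝ) *
        Real.exp (-(2 * θ * Fintype.card V)) * Real.exp (2 * θ * Fintype.card V) := by
        rw [mul_assoc, ← Real.exp_add, neg_add_cancel, Real.exp_zero, mul_one]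
    _ ≤ Real.exp (θ * Fintype.card V) * Real.exp (2 * θ * Fintype.card V) := by gcongr
    _ = _ := by rw [← Real.exp_add]; congr 1; ring

end Counting

/-! ### Elementary inequalities for the bets. -/

section Numerics

/-- The fair bets of the depth-first search. -/
lemma query_weight_le {p q y z ε : ℝ} (hp : 0 ≤ p) (hpq : p ≤ q) (hy : 0 ≤ y)
    (hz : 0 ≤ z) (hz1 : z ≤ 1) (hzε : z ≤ ε) (h : z * (1 + ε) ≤ p * (y - y ^ 2 / 2)) :
    q * Real.exp (-y) + (1 - q) * Real.exp z ≤ 1 := by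
  have h1 : Real.exp (-y) ≤ 1 - y + y ^ 2 / 2 := by
    have h2 := Real.quadratic_le_exp_of_nonneg hy
    have h3 : 0 < 1 - y + y ^ 2 / 2 := by nlinarith [sq_nonneg (y - 1)]
    rw [Real.exp_neg]
    refine inv_le_of_inv_le₀ h3 (le_trans ?_ h2)
    refine inv_le_of_inv_le₀ (by positivity) ?_
    rw [inv_le_iff_one_le_mul₀ (by positivity)]
    nlinarith [pow_nonneg hy 4]
  have h2 : Real.exp z ≤ 1 + z + z ^ 2 := by
    have := Real.abs_exp_sub_one_sub_id_le (x := z) (by rwa [abs_of_nonneg hz])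
    linarith [le_abs_self (Real.exp z - 1 - z)]
  have h3 : Real.exp (-y) ≤ 1 := Real.exp_le_one_iff.2 (by linarith)
  have h4 : 1 ≤ Real.exp z := Real.one_le_exp hz
  have h5 : p * (Real.exp z - Real.exp (-y)) ≤ q * (Real.exp z - Real.exp (-y)) :=
    mul_le_mul_of_nonneg_right hpq (by linarith)
  have h6 : p * (y - y ^ 2 / 2) ≤ p * (Real.exp z - Real.exp (-y)) :=
    mul_le_mul_of_nonneg_left (by linarith) hp
  have h7 : z * z ≤ z * ε := mul_le_mul_of_nonneg_left hzε hz
  nlinarith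

lemma exp_half_le {x : ℝ} (hx : 0 ≤ x) (hx1 : x ≤ 1) : Real.exp (x / 2) ≤ 1 + x := by
  have := Real.abs_exp_sub_one_sub_id_le (x := x / 2) (by rw [abs_of_nonneg] <;> linarith)
  have := le_abs_self (Real.exp (x / 2) - 1 - x / 2)
  nlinarith

end Numerics

/-! ### Long cycles survive every small deletion. -/

section ManyCycles

/-- Here `M` is the number of visited vertices. The cost is about `(ε / 4) ^ 2 * n`, and the gain
exceeds it by the factor `1 + 15 / 100 * ε`: the surplus `1 + ε` in `z` outweighs all losses. -/
lemma dfs_exponent_le {ε θ n z τ M ℓ : ℝ} (hε : 0 < ε) (hε1 : ε ≤ 1) (hn : 0 < n)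
    (hθ : θ ^ 2 ≤ ε / 100)
    (hz : z * n = (1 + ε) * (ε / 4 - (ε / 4) ^ 2 / 2)) (hM : M ≤ ε / 4 * n)
    (hM' : ε / 4 * n - 1 ≤ M) (hℓ : ℓ ≤ ε ^ 2 / 100 * n) (hℓM : ℓ ≤ M)
    (hτ : n - θ ^ 2 * n - M ≤ τ) :
    (ε / 4 + z) * M - z * τ * (M - ℓ) ≤ 2 - ε ^ 4 / 640000 * n := by
  set g : ℝ := (1 + ε) * (ε / 4 - (ε / 4) ^ 2 / 2) with hg
  have hg' : g = ε / 4 * ((1 + ε) * (1 - ε / 8)) := by rw [hg]; ring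
  have hg0 : 0 ≤ g := by
    rw [hg']
    have : 0 ≤ 1 - ε / 8 := by linarith
    positivity
  have hg1 : g ≤ 1 := by rw [hg']; nlinarith
  have hz0 : 0 ≤ z := by
    rw [← hz] at hg0
    exact nonneg_of_mul_nonneg_left hg0 hn
  -- At most `ε / 4 * n` visited and `ε / 100 * n` deleted vertices leave `τ ≥ r * n`.
  set r : ℝ := 1 - 26 / 100 * ε with hr
  have hr0 : 0 ≤ r := by linarith
  have hr1 : r ≤ 1 := by linarith
  have hrτ : r * n ≤ τ := by nlinarith
  have h1 : g * r ≤ z * τ := by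
    calc g * r = z * (r * n) := by rw [← hz]; ring
      _ ≤ z * τ := by gcongr
  have h2 : g * r * (M - ℓ) ≤ z * τ * (M - ℓ) := mul_le_mul_of_nonneg_right h1 (by linarith)
  have h3 : g * r * (ε / 4 * (1 - ε / 25) * n - 1) ≤ g * r * (M - ℓ) :=
    mul_le_mul_of_nonneg_left (by nlinarith) (by positivity)
  have h4 : g * r ≤ 1 := by nlinarith
  have h5 : z * M ≤ 1 := by
    calc z * M ≤ z * (ε / 4 * n) := by gcongr
      _ = ε / 4 * g := by rw [← hz]; ring
      _ ≤ 1 := by nlinarith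
  have h6 : 1 + 15 / 100 * ε ≤ (1 + ε) * ((1 - ε / 8) * (r * (1 - ε / 25))) := by
    have h7 : 1 - 30 / 100 * ε ≤ r * (1 - ε / 25) := by rw [hr]; nlinarith
    have h8 : 1 - 425 / 1000 * ε ≤ (1 - ε / 8) * (r * (1 - ε / 25)) := by
      have h9 : (1 - ε / 8) * (1 - 30 / 100 * ε) ≤ (1 - ε / 8) * (r * (1 - ε / 25)) :=
        mul_le_mul_of_nonneg_left h7 (by linarith)
      have h10 : (1 - ε / 8) * (1 - 30 / 100 * ε) =
          1 - 425 / 1000 * ε + 3 / 80 * (ε * ε) := by ring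
      have h11 : 0 ≤ ε * ε := mul_self_nonneg ε
      linarith
    have h9 : (1 + ε) * (1 - 425 / 1000 * ε) ≤ (1 + ε) * ((1 - ε / 8) * (r * (1 - ε / 25))) :=
      mul_le_mul_of_nonneg_left h8 (by linarith)
    have h10 : (1 + ε) * (1 - 425 / 1000 * ε) =
        1 + 15 / 100 * ε + 425 / 1000 * (ε - ε * ε) := by ring
    have h11 : ε * ε ≤ ε := mul_le_of_le_one_left hε.le hε1
    linarith
  have h9 : ε / 4 * (ε / 4 * n) * (1 + 15 / 100 * ε) ≤ g * r * (ε / 4 * (1 - ε / 25) * n) := by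
    calc _ ≤ ε / 4 * (ε / 4 * n) * ((1 + ε) * ((1 - ε / 8) * (r * (1 - ε / 25)))) := by gcongr
      _ = _ := by rw [hg']; ring
  have h10 : ε / 4 * M ≤ ε / 4 * (ε / 4 * n) := by gcongr
  -- The gain of order `ε ^ 3` is weakened to the rate of `back_weight_inv_le`, which comes from `(ε
  -- ^ 2 / 400 * n) ^ 2 / (4 * n)`.
  have h11 : ε ^ 4 / 640000 * n ≤ ε / 4 * (ε / 4 * n) * (15 / 100 * ε) := by
    have : ε ^ 4 ≤ ε ^ 3 := pow_le_pow_of_le_one hε.le hε1 (by norm_num)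
    have h3 : (0 : ℝ) < ε ^ 3 := by positivity
    calc _ ≤ (15 / 1600 * ε ^ 3) * n := by gcongr; linarith
      _ = _ := by ring
  linarith

lemma back_weight_inv_le {ε n : ℝ} {K h : ℕ} (hn : 1 ≤ n) (hK : (K : ℝ) ≤ n)
    (hε1 : ε ^ 2 ≤ 1) (hεn : 400 ≤ ε ^ 2 * n) (hh : ε ^ 2 / 400 * n - 1 ≤ h) :
    ((1 / 2 : ℝ) ^ K * (1 + 1 / n / 2) ^ (h * h - K))⁻¹ ≤
      2 ^ K * Real.exp (1 - ε ^ 4 / 640000 * n) := by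
  have hx : (1 : ℝ) / n / 2 ≤ 1 := by
    rw [div_div, div_le_one (by linarith)]; linarith
  have h1 : Real.exp (((h * h - K : ℕ) : ℝ) * (1 / n / 2 / 2)) ≤
      (1 + 1 / n / 2) ^ (h * h - K) := by
    rw [Real.exp_nat_mul]
    have := exp_half_le (x := 1 / n / 2) (by positivity) hx
    gcongr
  have h2 : (h : ℝ) * h - K ≤ ((h * h - K : ℕ) : ℝ) := by
    have : h * h ≤ (h * h - K) + K := by omega
    have : ((h * h : ℕ) : ℝ) ≤ ((h * h - K : ℕ) : ℝ) + K := by exact_mod_cast this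
    push_cast at this ⊢
    linarith
  have h3 : (ε ^ 2 / 400 * n - 1) * (ε ^ 2 / 400 * n - 1) ≤ (h : ℝ) * h :=
    mul_self_le_mul_self (by linarith) hh
  have h4 : ε ^ 4 / 640000 * n - 1 ≤ ((h * h - K : ℕ) : ℝ) * (1 / n / 2 / 2) := by
    rw [div_div, div_div, mul_one_div, le_div_iff₀ (by positivity)]
    nlinarith
  have h5 : Real.exp (ε ^ 4 / 640000 * n - 1) ≤ (1 + 1 / n / 2) ^ (h * h - K) :=
    (Real.exp_le_exp.2 h4).trans h1
  rw [mul_inv, one_div, inv_pow, inv_inv]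
  gcongr
  rw [show 1 - ε ^ 4 / 640000 * n = -(ε ^ 4 / 640000 * n - 1) by ring, Real.exp_neg]
  exact inv_anti₀ (Real.exp_pos _) h5

/-- Above the threshold, with probability at least `1 / 2` many long cycles remain after the removal
of any small set of vertices. -/
lemma exists_many_cycles {ε d θ : ℝ} (hε : 0 < ε) (hε1 : ε ≤ 1) (hd : (1 + ε) ^ 2 ≤ d)
    (hθ : θ = ε ^ 4 / 4000000) (K : ℕ) :
    ∃ n₀ : ℕ, ∀ n, n₀ ≤ n → ∀ c : Pair n → ℝ, (∀ e, c e ∈ Set.Icc (0 : ℝ) 1) →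
      (∀ x y, x ≠ y → c (x, y) = d / n) →
      bernExp c (fun A => ind (∃ S : Finset (Fin n), S.card ≤ ⌊θ ^ 2 * n⌋₊ ∧
        (longCycles A Sᶜ ⌊θ ^ 2 * n⌋₊).card ≤ K)) ≤ 1 / 2 := by
  have hθ0 : 0 < θ := by rw [hθ]; positivity
  have hε4 : ε ^ 4 ≤ ε ^ 2 := pow_le_pow_of_le_one hε.le hε1 (by norm_num)
  have hε2 : ε ^ 2 ≤ ε := by nlinarith
  have hθε : θ ≤ ε ^ 2 / 4000000 := by rw [hθ]; linarith
  have hθ1 : θ ≤ 1 := by nlinarith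
  have hθ2 : θ ^ 2 ≤ ε ^ 2 / 4000000 := by nlinarith
  have htend : Tendsto (fun n : ℕ => (Real.exp 2 + 2 ^ K * Real.exp 1) *
      Real.exp (-(ε ^ 4 / 1600000 * n))) atTop (𝓝 0) := by
    have h1 : Tendsto (fun n : ℕ => ε ^ 4 / 1600000 * (n : ℝ)) atTop atTop :=
      Tendsto.const_mul_atTop (by positivity) tendsto_natCast_atTop_atTop
    simpa using ((Real.tendsto_exp_neg_atTop_nhds_zero.comp h1).const_mul
      (Real.exp 2 + 2 ^ K * Real.exp 1))
  obtain ⟨n₁, hn₁⟩ := eventually_atTop.1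
    (htend.eventually (ge_mem_nhds (show (0 : ℝ) < 1 / 2 by norm_num)))
  obtain ⟨n₂, hn₂⟩ := exists_nat_ge (400 / ε ^ 2)
  refine ⟨max (max n₁ n₂) (max K 1), fun n hn c hc hcd => ?_⟩
  have hnn₁ : n₁ ≤ n := (le_max_left _ _).trans ((le_max_left _ _).trans hn)
  have hnn₂ : n₂ ≤ n := (le_max_right _ _).trans ((le_max_left _ _).trans hn)
  have hnK : K ≤ n := (le_max_left _ _).trans ((le_max_right _ _).trans hn)
  have hn1' : 1 ≤ n := (le_max_right _ _).trans ((le_max_right _ _).trans hn)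
  have hn1 : (1 : ℝ) ≤ n := by exact_mod_cast hn1'
  have hnpos : (0 : ℝ) < n := by linarith
  have hεn : 400 ≤ ε ^ 2 * n := by
    have : 400 / ε ^ 2 ≤ n := hn₂.trans (by exact_mod_cast hnn₂)
    rw [div_le_iff₀ (by positivity)] at this
    linarith
  have hεn' : 400 ≤ ε * n := hεn.trans (by gcongr)
  set m := ⌊θ ^ 2 * n⌋₊ with hm
  -- The search visits `M` vertices and seeks a path of length `ℓ`. Its two ends of size `h` leave
  -- room for cycles longer than `m`, since `2 * h + m ≤ ℓ`.
  set M := ⌊ε / 4 * n⌋₊ with hM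
  set ℓ := ⌊ε ^ 2 / 100 * n⌋₊ with hℓ
  set h := ⌊ε ^ 2 / 400 * n⌋₊ with hh
  have hmle : (m : ℝ) ≤ θ ^ 2 * n := Nat.floor_le (by positivity)
  have hMle : (M : ℝ) ≤ ε / 4 * n := Nat.floor_le (by positivity)
  have hMge : ε / 4 * n - 1 ≤ M := (Nat.sub_one_lt_floor _).le
  have hℓle : (ℓ : ℝ) ≤ ε ^ 2 / 100 * n := Nat.floor_le (by positivity)
  have hhle : (h : ℝ) ≤ ε ^ 2 / 400 * n := Nat.floor_le (by positivity)
  have hhge : ε ^ 2 / 400 * n - 1 ≤ h := (Nat.sub_one_lt_floor _).le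
  have hℓM : ℓ ≤ M := Nat.floor_le_floor (by gcongr; linarith)
  have hD : 2 * h + m ≤ ℓ := by
    refine Nat.le_floor ?_
    push_cast
    have : θ ^ 2 * n ≤ ε ^ 2 / 4000000 * n := by gcongr
    linarith
  set z : ℝ := (1 + ε) * (ε / 4 - (ε / 4) ^ 2 / 2) / n with hz
  have hzn : z * n = (1 + ε) * (ε / 4 - (ε / 4) ^ 2 / 2) := div_mul_cancel₀ _ hnpos.ne'
  have hge : 0 ≤ (1 + ε) * (ε / 4 - (ε / 4) ^ 2 / 2) :=
    mul_nonneg (by linarith) (by nlinarith)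
  have hz0 : 0 ≤ z := div_nonneg hge hnpos.le
  have hzε : z ≤ ε := by
    rw [hz, div_le_iff₀ hnpos]
    calc _ ≤ (1 + 1) * (ε / 4 - 0) := by
          gcongr
          · nlinarith
          · positivity
      _ ≤ ε * 1 := by linarith
      _ ≤ ε * n := by gcongr
  have hq : ∀ u v : Fin n, u ≠ v →
      c (u, v) * Real.exp (-(ε / 4)) + (1 - c (u, v)) * Real.exp z ≤ 1 := by
    intro u v huv
    refine query_weight_le (p := (1 + ε) ^ 2 / n) (ε := ε) (by positivity) ?_ (by positivity) hz0
      (by linarith) hzε (le_of_eq ?_)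
    · rw [hcd u v huv]; gcongr
    · rw [hz]; ring
  have hsingle : ∀ S : Finset (Fin n), S.card ≤ m →
      bernExp c (fun A => ind ((longCycles A Sᶜ m).card ≤ K)) ≤
        (Real.exp 2 + 2 ^ K * Real.exp 1) * Real.exp (-(ε ^ 4 / 640000 * n)) := by
    intro S hS
    have hU : Sᶜ.card + S.card = n := by
      rw [Finset.card_compl_add_card, Fintype.card_fin]
    have hUr : (Sᶜ.card : ℝ) = n - S.card := by
      rw [eq_sub_iff_add_eq]; exact_mod_cast hU
    have hSr : (S.card : ℝ) ≤ θ ^ 2 * n := le_trans (by exact_mod_cast hS) hmle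
    have hMU : M ≤ Sᶜ.card := by
      have : (M : ℝ) ≤ Sᶜ.card := by
        rw [hUr]
        have h1 : θ ^ 2 * n ≤ 1 / 4 * n := by gcongr; linarith
        have h2 : ε / 4 * n ≤ 1 / 4 * n := by gcongr
        linarith
      exact_mod_cast this
    have hτr : ((Sᶜ.card - M : ℕ) : ℝ) = Sᶜ.card - M := by
      rw [Nat.cast_sub hMU]
    refine (bernExp_few_cycles_le hc (by positivity : 0 ≤ ε / 4) hz0 hq
      (p := 1 / n) (by positivity) (fun u v huv => ?_) (Sᶜ.card - M) ℓ h m K Sᶜ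
      (Nat.sub_le _ _) hD).trans ?_
    · rw [hcd u v huv]
      gcongr
      exact (one_le_pow₀ (by linarith)).trans hd
    · have h1 := dfs_exponent_le (θ := θ) (z := z) (τ := ((Sᶜ.card - M : ℕ) : ℝ)) (M := M)
        (ℓ := ℓ) hε hε1 hnpos (by linarith) hzn hMle hMge hℓle (by exact_mod_cast hℓM)
        (by rw [hτr, hUr]; linarith)
      have h2 := back_weight_inv_le (ε := ε) (n := n) (K := K) (h := h) hn1
        (by exact_mod_cast hnK) (hε2.trans hε1) hεn hhge
      rw [show (Sᶜ.card : ℝ) - ((Sᶜ.card - M : ℕ) : ℝ) = M by rw [hτr]; ring]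
      refine (add_le_add (Real.exp_le_exp.2 h1) h2).trans (le_of_eq ?_)
      rw [sub_eq_add_neg, Real.exp_add, sub_eq_add_neg, Real.exp_add]
      ring
  calc _ ≤ bernExp c (fun A => ∑ S ∈ Finset.univ.filter fun S : Finset (Fin n) => S.card ≤ m,
        ind ((longCycles A Sᶜ m).card ≤ K)) := by
        refine bernExp_mono hc fun A => ind_le_of_imp
          (Finset.sum_nonneg fun _ _ => ind_nonneg _) ?_
        rintro ⟨S, hS, hF⟩
        rw [← ind_of_true hF]
        exact Finset.single_le_sum (f := fun S : Finset (Fin n) =>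
          ind ((longCycles A Sᶜ m).card ≤ K)) (fun _ _ => ind_nonneg _) (by simpa using hS)
    _ ≤ ((Finset.univ.filter fun S : Finset (Fin n) => S.card ≤ m).card : ℝ) *
        ((Real.exp 2 + 2 ^ K * Real.exp 1) * Real.exp (-(ε ^ 4 / 640000 * n))) := by
        rw [bernExp_sum, ← nsmul_eq_mul]
        exact Finset.sum_le_card_nsmul _ _ _ fun S hS => hsingle S (Finset.mem_filter.1 hS).2
    _ ≤ Real.exp (3 * θ * n) *
        ((Real.exp 2 + 2 ^ K * Real.exp 1) * Real.exp (-(ε ^ 4 / 640000 * n))) := by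
        gcongr
        have := card_small_sets_le (V := Fin n) (m := m) hθ0 hθ1 (by simpa using hmle)
        simpa using this
    _ = (Real.exp 2 + 2 ^ K * Real.exp 1) * Real.exp (3 * θ * n + -(ε ^ 4 / 640000 * n)) := by
        rw [Real.exp_add]; ring
    _ ≤ (Real.exp 2 + 2 ^ K * Real.exp 1) * Real.exp (-(ε ^ 4 / 1600000 * n)) := by
        gcongr
        -- The union bound costs `3 / 4000000`, and together with `1 / 1600000` this stays below `1
        -- / 640000`.
        rw [hθ]
        have : 0 ≤ ε ^ 4 * n := by positivity
        nlinarith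
    _ ≤ 1 / 2 := hn₁ n hnn₁

end ManyCycles

/-! ### Bounds for estimators and for the optimal error. -/

section Estimators

variable {X : Type*} [MeasurableSpace X] {n : ℕ} {d : ℝ}

/-- The derivative of `P` by itself is one only almost everywhere, so an MLE is controlled only
almost surely. -/
lemma ae_weightLaw (P : Measure X) [IsProbabilityMeasure P] (G : Finset (Pair n)) :
    ∀ᵐ w ∂(weightLaw P G), ∀ e, (e ∈ G → (w e).isLeft = true ∧ logLR P P (w e) = 0) ∧
      (e ∉ G → w e = Sum.inr ()) := by
  rw [ae_all_iff]
  intro e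
  have hedge : ∀ᵐ s ∂(if e ∈ G then P.map Sum.inl else Measure.dirac (Sum.inr ()) :
      Measure (X ⊕ Unit)), (e ∈ G → s.isLeft = true ∧ logLR P P s = 0) ∧
        (e ∉ G → s = Sum.inr ()) := by
    split_ifs with he
    · have hinl : MeasurableEmbedding (Sum.inl : X → X ⊕ Unit) :=
        ⟨Sum.inl_injective, measurable_inl, fun _ hs => measurableSet_inl_image.2 hs⟩
      rw [hinl.ae_map_iff]
      filter_upwards [P.rnDeriv_self] with x hx
      simp [he, logLR, hx]
    · have hset : MeasurableSet {s : X ⊕ Unit |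
          (e ∈ G → s.isLeft = true ∧ logLR P P s = 0) ∧ (e ∉ G → s = Sum.inr ())} := by
        convert measurableSet_range_inr (α := X) (β := Unit) using 1
        ext s
        rcases s with x | x <;> simp [he]
      rw [ae_dirac_iff hset]
      simp [he]
  exact (Measure.tendsto_eval_ae_ae (μ := fun e : Pair n =>
    (if e ∈ G then P.map Sum.inl else Measure.dirac (Sum.inr ()) : Measure (X ⊕ Unit)))
    (i := e)).eventually hedge

lemma IsMLE.ae_mem_perfectMatchings {P : Measure X} [IsProbabilityMeasure P]
    {Mhat : Observation n X → Finset (Pair n)} (hM : IsMLE P P Mhat) (G : Finset (Pair n))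
    (hG : (perfectMatchings G).Nonempty) :
    ∀ᵐ w ∂(weightLaw P G), ∃ τ ∈ perfectMatchings G, Mhat w = matching τ := by
  obtain ⟨σ, hσ⟩ := hG
  filter_upwards [ae_weightLaw P G] with w hw
  obtain ⟨⟨τ, hτ⟩, hmax⟩ := hM.2 w
  refine ⟨τ, ?_, hτ⟩
  by_contra hcon
  rw [mem_perfectMatchings] at hcon
  push Not at hcon
  obtain ⟨i, hi⟩ := hcon
  have h1 : ∑ e ∈ matching σ, logLR P P (w e) = 0 :=
    Finset.sum_eq_zero fun e he =>
      ((hw e).1 (matching_subset_iff.2 (mem_perfectMatchings.1 hσ) he)).2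
  -- In `EReal`, `⊥` absorbs every summand, even `⊤`, so one unconnected pair ruins a matching.
  have h2 : ∑ e ∈ matching τ, logLR P P (w e) = ⊥ := by
    rw [← Finset.add_sum_erase _ _ (mem_matching.2 rfl : (i, τ i) ∈ matching τ), (hw (i, τ i)).2 hi]
    exact EReal.bot_add _
  have := hmax σ
  rw [hτ, h1, h2] at this
  simp at this

open Classical in
/-- The estimator that chooses some perfect matching among the connected pairs. -/
noncomputable def someMatching (w : Observation n X) : Finset (Pair n) :=
  if h : (perfectMatchings (Finset.univ.filter fun e : Pair n => (w e).isLeft = true)).Nonempty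
  then matching h.choose else ∅

lemma measurable_someMatching : Measurable (someMatching : Observation n X → Finset (Pair n)) := by
  classical
  have h1 : Measurable fun (w : Observation n X) (e : Pair n) => (w e).isLeft := by
    refine measurable_pi_lambda _ fun e => ?_
    have : Measurable (Sum.isLeft : X ⊕ Unit → Bool) := by
      have h : (Sum.isLeft : X ⊕ Unit → Bool) = Sum.elim (fun _ => true) fun _ => false := by
        funext s; cases s <;> rfl
      rw [h]
      exact measurable_const.sumElim measurable_const
    exact this.comp (measurable_pi_apply e)
  exact (measurable_of_countable fun b : Pair n → Bool =>
    if h : (perfectMatchings (Finset.univ.filter fun e : Pair n => b e = true)).Nonempty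
    then matching h.choose else ∅).comp h1

lemma someMatching_ae_mem_perfectMatchings (P : Measure X) [IsProbabilityMeasure P]
    (G : Finset (Pair n)) (hG : (perfectMatchings G).Nonempty) :
    ∀ᵐ w ∂(weightLaw P G), ∃ τ ∈ perfectMatchings G, someMatching w = matching τ := by
  filter_upwards [ae_weightLaw P G] with w hw
  have h : (Finset.univ.filter fun e : Pair n => (w e).isLeft = true) = G := by
    ext e
    by_cases he : e ∈ G
    · simp [he, ((hw e).1 he).1]
    · simp [he, (hw e).2 he]
  rw [someMatching]
  simp only [h]
  rw [dif_pos hG]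
  exact ⟨_, hG.choose_spec, rfl⟩

lemma exists_avgError_le {ε d : ℝ} (hε : 0 < ε) (hd0 : 0 ≤ d) (hd : d ≤ (1 + ε) ^ 2) :
    ∃ n₀ : ℕ, ∀ n, n₀ ≤ n → ∀ (X : Type u) [MeasurableSpace X] (P : Measure X)
      [IsProbabilityMeasure P] (Mhat : Observation n X → Finset (Pair n)), Measurable Mhat →
      (∀ G : Finset (Pair n), (perfectMatchings G).Nonempty → ∀ᵐ w ∂(weightLaw P G),
        ∃ τ ∈ perfectMatchings G, Mhat w = matching τ) →
      avgError n d P P Mhat ≤ 68 * ε := by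
  obtain ⟨n₁, hn₁⟩ := exists_nat_ge d
  rcases le_or_gt ε 1 with hε1 | hε1
  · obtain ⟨n₀, hn₀⟩ := exists_support_bound hε hε1 hd0 hd
    refine ⟨max (max n₀ n₁) 1, fun n hn X _ P _ Mhat hM hPM => ?_⟩
    have hdn : d ≤ n := hn₁.trans (by
      exact_mod_cast (le_max_right _ _).trans ((le_max_left _ _).trans hn))
    have hnpos : (0 : ℝ) < n := by exact_mod_cast (le_max_right _ _).trans hn
    obtain ⟨f, hf, hb⟩ := hn₀ n ((le_max_left _ _).trans ((le_max_left _ _).trans hn))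
      (fun e => if e.1 = e.2 then 1 else d / n)
      (fun e => by split_ifs; exacts [by simp, div_mem_Icc hd0 hdn])
      (fun x y hxy => if_neg hxy)
    refine (avgError_le_of_forall P hd0 hdn hM hPM hf hb).trans (le_of_eq ?_)
    field_simp
    norm_num
  -- For `ε > 1` the trivial bound `2` on the loss of two perfect matchings is enough.
  · refine ⟨max n₁ 1, fun n hn X _ P _ Mhat hM hPM => ?_⟩
    have hdn : d ≤ n := hn₁.trans (by exact_mod_cast (le_max_left _ _).trans hn)
    have hnpos : (0 : ℝ) < n := by exact_mod_cast (le_max_right _ _).trans hn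
    refine (avgError_le_of_forall P hd0 hdn hM hPM (f := fun _ => n) (fun A π _ => ?_)
      (bernExp_const _ _).le).trans ?_
    · exact_mod_cast (Finset.card_le_univ π.support).trans (by simp)
    · rw [div_mul_cancel₀ _ hnpos.ne']
      linarith

lemma exists_le_avgError {ε d : ℝ} (hε : 0 < ε) (hε1 : ε ≤ 1) (hd : (1 + ε) ^ 2 ≤ d) :
    ∃ n₀ : ℕ, ∀ n, n₀ ≤ n → ∀ (X : Type u) [MeasurableSpace X] (P : Measure X)
      [IsProbabilityMeasure P] (Mhat : Observation n X → Finset (Pair n)), Measurable Mhat →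
      1 / 64000000000000 * ε ^ 8 ≤ avgError n d P P Mhat := by
  set θ : ℝ := ε ^ 4 / 4000000 with hθ
  have hθ0 : 0 < θ := by positivity
  -- `K` does not depend on `n`, yet `K * (m + 1) ≥ n`; a bounded number of long cycles is all that
  -- the counting needs.
  obtain ⟨K, hK⟩ := exists_nat_ge (1 / θ ^ 2)
  obtain ⟨n₀, hn₀⟩ := exists_many_cycles hε hε1 hd hθ K
  obtain ⟨n₁, hn₁⟩ := exists_nat_ge d
  have hdpos : 0 < d := lt_of_lt_of_le (by positivity) hd
  refine ⟨max (max n₀ n₁) 1, fun n hn X _ P _ Mhat hM => ?_⟩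
  have hdn : d ≤ n := hn₁.trans (by
    exact_mod_cast (le_max_right _ _).trans ((le_max_left _ _).trans hn))
  have hnpos : (0 : ℝ) < n := hdpos.trans_le hdn
  have hc : ∀ e : Pair n, (if e.1 = e.2 then 1 else d / n) ∈ Set.Icc (0 : ℝ) 1 := fun e => by
    split_ifs; exacts [by simp, div_mem_Icc hdpos.le hdn]
  have hbad := hn₀ n ((le_max_left _ _).trans ((le_max_left _ _).trans hn))
    (fun e => if e.1 = e.2 then 1 else d / n) hc (fun x y hxy => if_neg hxy)
  set m := ⌊θ ^ 2 * n⌋₊ with hm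
  have hm1 : θ ^ 2 * n ≤ m + 1 := (Nat.lt_floor_add_one _).le
  have hKm : n ≤ K * (m + 1) := by
    have : (n : ℝ) ≤ K * (m + 1) := by
      calc (n : ℝ) = 1 / θ ^ 2 * (θ ^ 2 * n) := by field_simp
        _ ≤ K * (m + 1) := by gcongr
    exact_mod_cast this
  refine le_avgError P hdpos hdn hM (le_trans ?_ (bernExp_mono_of_subset hc
    (f := fun A => θ ^ 2 / 2 * (1 - ind (∃ S : Finset (Fin n), S.card ≤ m ∧
      (longCycles A Sᶜ m).card ≤ K))) fun A hA => ?_))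
  · rw [bernExp_const_mul, bernExp_one_sub]
    -- The good event has probability at least `1 / 2`, and on it the mean support is at least `θ ^
    -- 2 / 2 * n`; the constant is `θ ^ 2 / 4`.
    calc 1 / 64000000000000 * ε ^ 8 = θ ^ 2 / 2 * (1 - 1 / 2) := by rw [hθ]; ring
      _ ≤ _ := by gcongr
  · by_cases h : ∃ S : Finset (Fin n), S.card ≤ m ∧ (longCycles A Sᶜ m).card ≤ K
    · rw [ind_of_true h, sub_self, mul_zero]
      exact div_nonneg (Finset.sum_nonneg fun _ _ => Nat.cast_nonneg _)
        (mul_nonneg (Nat.cast_nonneg _) (Nat.cast_nonneg _))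
    · rw [ind_of_false h, sub_zero, mul_one]
      push Not at h
      have h1 : (1 : Equiv.Perm (Fin n)) ∈ perfectMatchings A :=
        mem_perfectMatchings.2 fun i => hA _ (by simp)
      have hpos : (0 : ℝ) < (perfectMatchings A).card := by
        exact_mod_cast Finset.card_pos.2 ⟨_, h1⟩
      rw [le_div_iff₀ (mul_pos hnpos hpos)]
      refine le_trans ?_ (le_sum_support hKm h)
      calc _ = θ ^ 2 * n / 2 * (perfectMatchings A).card := by ring
        _ ≤ _ := by gcongr

lemma bddBelow_avgError (P : Measure X) : BddBelow (Set.range fun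
    Mhat : {f : Observation n X → Finset (Pair n) // Measurable f} => avgError n d P P Mhat.1) :=
  ⟨0, by rintro _ ⟨M, rfl⟩; exact avgError_nonneg P _⟩

lemma optimalError_nonneg (P : Measure X) : 0 ≤ optimalError n d P P :=
  Real.iInf_nonneg fun _ => avgError_nonneg P _

lemma eventually_optimalError_le {ε d : ℝ} (hε : 0 < ε) (hd0 : 0 ≤ d) (hd : d ≤ (1 + ε) ^ 2)
    (P : Measure X) [IsProbabilityMeasure P] :
    ∀ᶠ n : ℕ in atTop, optimalError n d P P ≤ 68 * ε := by
  obtain ⟨n₀, hn₀⟩ := exists_avgError_le hε hd0 hd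
  filter_upwards [eventually_ge_atTop n₀] with n hn
  exact (ciInf_le (bddBelow_avgError P) ⟨someMatching, measurable_someMatching⟩).trans
    (hn₀ n hn X P _ measurable_someMatching (someMatching_ae_mem_perfectMatchings P))

lemma eventually_le_optimalError {ε d : ℝ} (hε : 0 < ε) (hε1 : ε ≤ 1) (hd : (1 + ε) ^ 2 ≤ d)
    (P : Measure X) [IsProbabilityMeasure P] :
    ∀ᶠ n : ℕ in atTop, 1 / 64000000000000 * ε ^ 8 ≤ optimalError n d P P := by
  obtain ⟨n₀, hn₀⟩ := exists_le_avgError hε hε1 hd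
  filter_upwards [eventually_ge_atTop n₀] with n hn
  have : Nonempty {f : Observation n X → Finset (Pair n) // Measurable f} :=
    ⟨⟨fun _ => ∅, measurable_const⟩⟩
  exact le_ciInf fun M => hn₀ n hn X P M.1 M.2

lemma tendsto_optimalError_of_le_one {d : ℝ} (hd0 : 0 ≤ d) (hd : d ≤ 1) (P : Measure X)
    [IsProbabilityMeasure P] : Tendsto (fun n : ℕ => optimalError n d P P) atTop (𝓝 0) := by
  rw [Metric.tendsto_nhds]
  intro η hη
  filter_upwards [eventually_optimalError_le (ε := η / 136) (by positivity) hd0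
    (hd.trans (one_le_pow₀ (by linarith [show 0 < η / 136 by positivity]))) P] with n hn
  rw [Real.dist_eq, sub_zero, abs_of_nonneg (optimalError_nonneg P)]
  linarith

lemma tendsto_optimalError_iff {d : ℝ} (hd0 : 0 ≤ d) (P : Measure X) [IsProbabilityMeasure P] :
    Tendsto (fun n : ℕ => optimalError n d P P) atTop (𝓝 0) ↔ d ≤ 1 := by
  refine ⟨fun h => ?_, fun hd => tendsto_optimalError_of_le_one hd0 hd P⟩
  by_contra! hd
  -- For `ε ≤ 1` one has `(1 + ε) ^ 2 ≤ 1 + 3 * ε ≤ d`.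
  set ε : ℝ := min ((d - 1) / 3) 1 with hε
  have hε0 : 0 < ε := lt_min (by linarith) one_pos
  have hε1 : ε ≤ 1 := min_le_right _ _
  have hεd : ε ≤ (d - 1) / 3 := min_le_left _ _
  have h1 := ge_of_tendsto h (eventually_le_optimalError hε0 hε1 (by nlinarith) P)
  have : 0 < ε ^ 8 := by positivity
  linarith

end Estimators

/-! ### Regularity of limiting errors at the threshold. -/

section LimitingError

/-- A function that vanishes to the left of `a` and grows at least like `(x - a) ^ k` to the right is
not `k` times continuously differentiable at `a`. -/
lemma not_contDiffAt_of_le {f : ℝ → ℝ} {a r b : ℝ} {k : ℕ} (hr : 0 < r) (hb : 0 < b)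
    (h0 : ∀ x ∈ Set.Icc (a - r) a, f x = 0)
    (h1 : ∀ x ∈ Set.Ioc a (a + r), b * (x - a) ^ k ≤ f x) : ¬ ContDiffAt ℝ k f a := by
  intro hf
  -- Derivatives of a smooth function at `a` can be computed from the left, where `f` vanishes.
  -- Hence the Taylor polynomial is zero and `f x = o((x - a) ^ k)`, against the growth on the
  -- right.
  have hderiv : ∀ j ≤ k, iteratedDeriv j f a = 0 := by
    intro j hj
    have ha : a ∈ Set.Icc (a - r) a := ⟨by linarith, le_rfl⟩
    rw [← iteratedDerivWithin_eq_iteratedDeriv (uniqueDiffOn_Icc (by linarith : a - r < a))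
      (hf.of_le (by exact_mod_cast hj)) ha,
      iteratedDerivWithin_congr (g := 0) (fun x hx => h0 x hx) ha, iteratedDerivWithin_const_zero]
  obtain ⟨u, hu, hfu⟩ := hf.contDiffOn le_rfl (by simp)
  obtain ⟨s, hs, hsu⟩ := Metric.mem_nhds_iff.1 hu
  have hball : a ∈ Metric.ball a s := Metric.mem_ball_self hs
  have htaylor := taylor_isLittleO (convex_ball a s) hball (hfu.mono hsu)
  have hT : ∀ x, taylorWithinEval f k (Metric.ball a s) a x = 0 := by
    intro x
    rw [taylor_within_apply]
    refine Finset.sum_eq_zero fun j hj => ?_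
    have hjk : j ≤ k := Nat.lt_succ_iff.1 (Finset.mem_range.1 hj)
    rw [iteratedDerivWithin_eq_iteratedDeriv Metric.isOpen_ball.uniqueDiffOn
      (hf.of_le (by exact_mod_cast hjk)) hball, hderiv j hjk, smul_zero]
  simp only [hT, sub_zero] at htaylor
  rw [Metric.isOpen_ball.nhdsWithin_eq hball] at htaylor
  have h2 := htaylor.def (half_pos hb)
  have h3 : ∀ᶠ x in 𝓝[>] a, False := by
    filter_upwards [nhdsWithin_le_nhds h2, Ioc_mem_nhdsGT (show a < a + r by linarith)] with x hx hxr
    have hpos : 0 < (x - a) ^ k := pow_pos (by linarith [hxr.1]) k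
    have := h1 x hxr
    rw [Real.norm_of_nonneg hpos.le] at hx
    have h4 := (Real.le_norm_self (f x)).trans hx
    nlinarith
  exact h3.exists.choose_spec

variable {X : Type*} [MeasurableSpace X] {P : Measure X} {R : ℝ → ℝ} {d : ℝ}

lemma mapClusterPt_mem_of_eventually {u : ℕ → ℝ} {x : ℝ} {s : Set ℝ} (hx : MapClusterPt x atTop u)
    (hs : IsClosed s) (h : ∀ᶠ n in atTop, u n ∈ s) : x ∈ s := by
  rw [← hs.closure_eq]
  exact mem_closure_iff_clusterPt.2 (ClusterPt.mono hx (le_principal_iff.2 h))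

lemma IsLimitingError.nonneg (hR : IsLimitingError P P R) (hd : 0 ≤ d) : 0 ≤ R d :=
  mapClusterPt_mem_of_eventually (hR d hd) isClosed_Ici
    (Eventually.of_forall fun _ => optimalError_nonneg P)

variable [IsProbabilityMeasure P]

lemma IsLimitingError.le {ε : ℝ} (hR : IsLimitingError P P R) (hε : 0 < ε) (hd0 : 0 ≤ d)
    (hd : d ≤ (1 + ε) ^ 2) : R d ≤ 68 * ε :=
  mapClusterPt_mem_of_eventually (s := Set.Iic (68 * ε)) (hR d hd0) isClosed_Iic
    (eventually_optimalError_le hε hd0 hd P)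

lemma IsLimitingError.ge {ε : ℝ} (hR : IsLimitingError P P R) (hε : 0 < ε) (hε1 : ε ≤ 1)
    (hd : (1 + ε) ^ 2 ≤ d) : 1 / 64000000000000 * ε ^ 8 ≤ R d :=
  mapClusterPt_mem_of_eventually (hR d ((sq_nonneg _).trans hd)) isClosed_Ici
    (eventually_le_optimalError hε hε1 hd P)

lemma IsLimitingError.eq_zero (hR : IsLimitingError P P R) (hd0 : 0 ≤ d) (hd : d ≤ 1) :
    R d = 0 := by
  refine le_antisymm (le_of_forall_pos_le_add fun η hη => ?_) (hR.nonneg hd0)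
  have := hR.le (ε := η / 68) (by positivity) hd0
    (hd.trans (one_le_pow₀ (by linarith [show 0 < η / 68 by positivity])))
  linarith

lemma IsLimitingError.continuousAt (hR : IsLimitingError P P R) : ContinuousAt R 1 := by
  rw [ContinuousAt, hR.eq_zero zero_le_one le_rfl]
  have h1 : Tendsto (fun d : ℝ => 68 * |d - 1|) (𝓝 1) (𝓝 0) := by
    have : Continuous fun d : ℝ => 68 * |d - 1| := by fun_prop
    simpa using this.tendsto 1
  refine squeeze_zero_norm' ?_ h1
  filter_upwards [lt_mem_nhds (show (0 : ℝ) < 1 by norm_num)] with d hd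
  rw [Real.norm_of_nonneg (hR.nonneg hd.le)]
  rcases le_or_gt d 1 with h | h
  · rw [hR.eq_zero hd.le h]; positivity
  · rw [abs_of_pos (by linarith)]
    -- Applied with `ε = d - 1`, as `d ≤ d ^ 2`.
    exact hR.le (by linarith) hd.le (by nlinarith)

lemma IsLimitingError.not_contDiffAt (hR : IsLimitingError P P R) : ¬ ContDiffAt ℝ 8 R 1 := by
  -- The factor `3 ^ 8` comes from `ε = (x - 1) / 3`; radius one keeps the left interval within `d ≥
  -- 0`.
  refine not_contDiffAt_of_le (k := 8) (r := 1) (b := 1 / 64000000000000 / 3 ^ 8) one_pos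
    (by norm_num) (fun x hx => hR.eq_zero (by linarith [hx.1]) hx.2) fun x hx => ?_
  have h1 := hx.1
  have h2 := hx.2
  refine le_trans (le_of_eq ?_) (hR.ge (ε := (x - 1) / 3) (by linarith) (by linarith) (by nlinarith))
  rw [div_pow]
  ring

end LimitingError

end PlantedMatching

theorem mainTheorem4 :
    ∃ c C : ℝ, 0 < c ∧ 0 < C ∧
      -- every estimator has error at least of order `ε ^ 8`
      (∀ ε : ℝ, 0 < ε → ε ≤ 1 → ∀ d : ℝ, (1 + ε) ^ 2 ≤ d →
        ∃ n₀ : ℕ, ∀ n : ℕ, n₀ ≤ n →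
          ∀ (X : Type u) [MeasurableSpace X] (P : Measure X) [IsProbabilityMeasure P]
            (Mhat : PlantedMatching.Observation n X → Finset (PlantedMatching.Pair n)),
            Measurable Mhat → c * ε ^ 8 ≤ PlantedMatching.avgError n d P P Mhat) ∧
      -- every maximum likelihood estimator has error at most of order `ε`
      (∀ ε : ℝ, 0 < ε → ∀ d : ℝ, 0 ≤ d → d ≤ (1 + ε) ^ 2 →
        ∃ n₀ : ℕ, ∀ n : ℕ, n₀ ≤ n →
          ∀ (X : Type u) [MeasurableSpace X] (P : Measure X) [IsProbabilityMeasure P]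
            (Mhat : PlantedMatching.Observation n X → Finset (PlantedMatching.Pair n)),
            PlantedMatching.IsMLE P P Mhat → PlantedMatching.avgError n d P P Mhat ≤ C * ε) ∧
      -- the phase transition takes place at `d = 1` and is of finite order
      (∀ (X : Type u) [MeasurableSpace X] (P : Measure X) [IsProbabilityMeasure P],
        (∀ d : ℝ, 0 ≤ d →
          (Tendsto (fun n : ℕ => PlantedMatching.optimalError n d P P) atTop (𝓝 0) ↔ d ≤ 1)) ∧
        ∀ R : ℝ → ℝ, PlantedMatching.IsLimitingError P P R →
          ContinuousAt R 1 ∧ ¬ ContDiffAt ℝ 8 R 1) := by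
  refine ⟨1 / 64000000000000, 68, by norm_num, by norm_num,
    fun ε hε hε1 d hd => PlantedMatching.exists_le_avgError hε hε1 hd, fun ε hε d hd0 hd => ?_,
    fun X _ P _ => ⟨fun d hd => PlantedMatching.tendsto_optimalError_iff hd P,
      fun R hR => ⟨hR.continuousAt, hR.not_contDiffAt⟩⟩⟩
  obtain ⟨n₀, hn₀⟩ := PlantedMatching.exists_avgError_le hε hd0 hd
  exact ⟨n₀, fun n hn X _ P _ Mhat hM => hn₀ n hn X P Mhat hM.1 hM.ae_mem_perfectMatchings⟩
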